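/- Let $k$ be an arbitrary field and let $v$ be the $t$-adic valuation on the rational function field $k(t)$. Then the valued field $(k(t),v)$ is defectless but not algebraically maximal. Here, for a valued field $(K,v)$, a finite extension $L$ of $K$ and an extension $w$ of $v$ to $L$, the defect of $w/v$ is $$d(w/v)=\frac{[L^h:K^h]}{e(w/v)\,f(w/v)},$$ where $e(w/v)=(wL:vK)$ is the ramification index, $f(w/v)=[Lw:Kv]$ is the inertia degree, and $K^h\subseteq L^h$ are the henselizations of $(K,v)$ and $(L,w)$ inside an algebraic closure $\overline L=\overline K$ with respect to an extension $\overline w$ of $w$ to $\overline L$; that is, $K^h$ is the fixed field of $\{\sigma\in\mathrm{Gal}(K^{\mathrm{sep}}|K) : \overline w\circ\sigma=\overline w \text{ on } K^{\mathrm{sep}}\}$ with $K^{\mathrm{sep}}\subseteq\overline K$ the separable closure of $K$, and similarly for $L^h$. The valued field $(K,v)$ is defectless if $d(w/v)=1$ for every finite extension $(L|K,w|v)$ of valued fields. It is algebraically maximal if every algebraic valued field extension $(L|K,w|v)$ that is immediate (that is, $wL=vK$ and $Lw=Kv$) satisfies $L=K$. -/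

import Mathlib

universe u

noncomputable section

namespace ValuedFieldExt

open MonoidWithZeroHom IsLocalRing

/-! A valued field is a field `K` with a (Krull) valuation `v : Valuation K Γ`, written
multiplicatively. A valued field extension `(L|K, w|v)` is `[Algebra K L]` together with
`v.HasExtension w`, that is, the restriction of `w` to `K` is equivalent to `v`. -/

section Invariants

variable {K L Γ Δ : Type*} [Field K] [Field L] [Algebra K L]
  [LinearOrderedCommGroupWithZero Γ] [LinearOrderedCommGroupWithZero Δ]

/-- The value group `wL` of `w`. -/
def valGroup (w : Valuation L Δ) : Subgroup Δˣ :=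
  valueGroup (.ofClass w)

variable (K) in
/-- The value group of the restriction `w|_K`, as a subgroup of `wL`: this is the copy of `vK`
in `wL` when `w` extends `v`. -/
def baseValGroup (w : Valuation L Δ) : Subgroup Δˣ :=
  valGroup (w.comap (algebraMap K L))

variable (K) in
/-- The ramification index `e(w/v) = (wL : vK)`. -/
def ramIndex (w : Valuation L Δ) : ℕ :=
  (baseValGroup K w).relIndex (valGroup w)

/-- The inertia degree `f(w/v) = [Lw : Kv]`. -/
def inertiaDegree (v : Valuation K Γ) (w : Valuation L Δ) [v.HasExtension w] : ℕ :=
  Module.finrank (ResidueField v.valuationSubring) (ResidueField w.valuationSubring)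

/-- `(L|K, w|v)` is immediate: `wL = vK` and `Lw = Kv`. -/
def IsImmediate (v : Valuation K Γ) (w : Valuation L Δ) [v.HasExtension w] : Prop :=
  valGroup w = baseValGroup K w ∧
    Function.Bijective
      (algebraMap (ResidueField v.valuationSubring) (ResidueField w.valuationSubring))

end Invariants

section Henselization

variable (K : Type*) {Ω Δ : Type*} [Field K] [Field Ω] [Algebra K Ω]
  [LinearOrderedCommGroupWithZero Δ]

/-- The decomposition group `{σ ∈ Gal(K^sep | K) ∣ v̄ ∘ σ = v̄}` of a valuation `v̄` of `Ω`, where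
`K^sep` is the separable closure of `K` in `Ω`. -/
def decompositionGroup (vbar : Valuation Ω Δ) :
    Subgroup (separableClosure K Ω ≃ₐ[K] separableClosure K Ω) where
  carrier := {σ | ∀ x : separableClosure K Ω, vbar (σ x : Ω) = vbar (x : Ω)}
  one_mem' := fun _ => rfl
  mul_mem' := fun {σ τ} hσ hτ x => (hσ (τ x)).trans (hτ x)
  inv_mem' := fun {σ} hσ x => by
    have h := hσ (σ⁻¹ x)
    rw [← AlgEquiv.mul_apply, mul_inv_cancel, AlgEquiv.one_apply] at h
    exact h.symm

/-- The henselization `K^h` of `(K, v̄|_K)` inside an algebraic closure `Ω` of `K`: the fixed field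
of the decomposition group of `v̄`. -/
def henselization (vbar : Valuation Ω Δ) : IntermediateField K Ω :=
  IntermediateField.lift (IntermediateField.fixedField (decompositionGroup K vbar))

end Henselization

section Defect

variable {K L Ω Γ Δ Θ : Type*} [Field K] [Field L] [Field Ω] [Algebra K L] [Algebra K Ω]
  [Algebra L Ω] [IsScalarTower K L Ω] [LinearOrderedCommGroupWithZero Γ]
  [LinearOrderedCommGroupWithZero Δ] [LinearOrderedCommGroupWithZero Θ]

/-- The defect `d(w/v) = [L^h : K^h] / (e(w/v) f(w/v))` of a finite valued field extension
`(L|K, w|v)`. The henselizations `K^h ⊆ L^h` are taken inside an algebraic closure `Ω` of `L`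
(and of `K`) with respect to an extension `wbar` of `w` to `Ω`. -/
def defect (v : Valuation K Γ) (w : Valuation L Δ) [v.HasExtension w]
    (wbar : Valuation Ω Θ) : ℚ :=
  (IntermediateField.relfinrank (henselization K wbar)
      ((henselization L wbar).restrictScalars K) : ℚ) /
    ((ramIndex K w : ℚ) * (inertiaDegree v w : ℚ))

end Defect

section Properties

variable {K : Type u} {Γ : Type*} [Field K] [LinearOrderedCommGroupWithZero Γ]

/-- `(L|K, w|v)` is a defectless extension: `d(w/v) = 1`. The defect does not depend on the
extension of `w` to the algebraic closure used to form the henselizations; the definition asks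
for defect `1` with respect to each of them. -/
def IsDefectlessExtension (v : Valuation K Γ) {L Δ : Type u} [Field L] [Algebra K L]
    [LinearOrderedCommGroupWithZero Δ] (w : Valuation L Δ) [v.HasExtension w] : Prop :=
  ∀ (Θ : Type u) [LinearOrderedCommGroupWithZero Θ] (wbar : Valuation (AlgebraicClosure L) Θ)
    [w.HasExtension wbar], defect v w wbar = 1

/-- The valued field `(K, v)` is defectless: every finite valued field extension of it is a
defectless extension. -/
def IsDefectless (v : Valuation K Γ) : Prop :=
  ∀ (L : Type u) [Field L] [Algebra K L] [FiniteDimensional K L]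
    (Δ : Type u) [LinearOrderedCommGroupWithZero Δ] (w : Valuation L Δ) [v.HasExtension w],
    IsDefectlessExtension v w

/-- The valued field `(K, v)` is algebraically maximal: it has no proper algebraic immediate
valued field extension. -/
def IsAlgebraicallyMaximal (v : Valuation K Γ) : Prop :=
  ∀ (L : Type u) [Field L] [Algebra K L] [Algebra.IsAlgebraic K L]
    (Δ : Type u) [LinearOrderedCommGroupWithZero Δ] (w : Valuation L Δ) [v.HasExtension w],
    IsImmediate v w → Function.Surjective (algebraMap K L)

end Properties

end ValuedFieldExt

end

/-! Defectlessness. Inside an algebraic closure `Ω`, the degree `[L^h : K^h]` (`henselDegree`) and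
the product `e f` (`ramInertia`) are both multiplicative in towers. It therefore suffices to show
that they agree and are nonzero for normal extensions: if `N` is the normal closure of `L|K`, then
`N|K` and `N|L` are both normal, and the factor of `N|L` cancels. A normal extension is a Galois
extension followed by a purely inseparable one. In the Galois case both numbers equal the order of
the decomposition group: `ramInertia_eq_card` combines `g e f = n` with orbit-stabilizer, and
`henselDegree_eq_card` counts the conjugates of a primitive element over `K^h`. In the purely
inseparable case both equal the degree: `ramInertia_eq_finrank` holds because only one prime lies
above, and `henselDegree_eq_finrank_of_isPurelyInseparable` because `L^h = L K^h` with `K^h|K`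
separable.

The identity `∑ e f = n` needs the integral closure of `k[X]` to be a finite module, also in
inseparable extensions and for imperfect `k`. This is `finite_integralClosure_polynomial`: adjoining
`p`-power roots of `X` and of finitely many constants gives another polynomial ring, over whose
fraction field the extension becomes separable.

Failure of algebraic maximality. Since `k(X)` is dense in `k((X))`, every intermediate field is
immediate over `k(X)`. The Catalan generating function `c` gives the root `X c` of `Y² - Y + X` in
`k((X))`, and no rational function is a root. -/

namespace ValuedFieldExt
open IntermediateField

/-! ### Henselizations via isometries of `Ω`, and `L^h = L K^h`. -/

section HenselizationBasic
variable {K Ω Θ : Type*} [Field K] [Field Ω] [Algebra K Ω] [LinearOrderedCommGroupWithZero Θ]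

theorem exists_pow_mem_separableClosure (K : Type*) {Ω : Type*} [Field K] [Field Ω] [Algebra K Ω]
    [Algebra.IsAlgebraic K Ω] (x : Ω) :
    ∃ n : ℕ, n ≠ 0 ∧ x ^ n ∈ separableClosure K Ω := by
  obtain ⟨q, _⟩ := ExpChar.exists K
  have : ExpChar (separableClosure K Ω) q :=
    expChar_of_injective_algebraMap (algebraMap K _).injective q
  obtain ⟨n, y, hy⟩ := IsPurelyInseparable.pow_mem (separableClosure K Ω) q x
  exact ⟨q ^ n, (expChar_pow_pos K q n).ne', hy ▸ y.2⟩

theorem valuation_eq_of_pow_eq (v : Valuation Ω Θ) {x y : Ω} {n : ℕ} (hn : n ≠ 0)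
    (h : v (x ^ n) = v (y ^ n)) : v x = v y := by
  rw [map_pow, map_pow] at h
  exact (pow_left_inj₀ zero_le zero_le hn).1 h

/-- Some power of `x` is separable over `K`, and values have at most one `n`-th root in `Θ`. -/
theorem map_eq_of_forall_separable [Algebra.IsAlgebraic K Ω] (wbar : Valuation Ω Θ) (σ : Ω ≃ₐ[K] Ω)
    (h : ∀ x ∈ separableClosure K Ω, wbar (σ x) = wbar x) (x : Ω) : wbar (σ x) = wbar x := by
  obtain ⟨n, hn, hx⟩ := exists_pow_mem_separableClosure K x
  exact valuation_eq_of_pow_eq wbar hn (by rw [← map_pow, h _ hx])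

/-- Trades automorphisms of `K^sep`, which varies with `K`, for automorphisms of the fixed field
`Ω`. Isometries of `Ω` restrict to `K^sep`; conversely any lift of an isometry of `K^sep` is an
isometry, as values on `K^sep` determine those on `Ω`. -/
theorem mem_henselization_iff [Normal K Ω] (wbar : Valuation Ω Θ) (x : Ω) :
    x ∈ henselization K wbar ↔ IsSeparable K x ∧
      ∀ σ : Ω ≃ₐ[K] Ω, (∀ y, wbar (σ y) = wbar y) → σ x = x := by
  have : Algebra.IsAlgebraic K Ω := Normal.toIsAlgebraic
  constructor
  · intro hx
    have hs := IntermediateField.lift_le _ hx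
    refine ⟨mem_separableClosure_iff.1 hs, fun σ hσ => ?_⟩
    have hx' := (IntermediateField.mem_lift (⟨x, hs⟩ : separableClosure K Ω)).1 hx
    have := (mem_fixedField_iff _ _).1 hx' (σ.restrictNormal (separableClosure K Ω)) fun y => by
      rw [← hσ y]
      exact congrArg wbar (σ.restrictNormal_commutes (separableClosure K Ω) y)
    exact (σ.restrictNormal_commutes (separableClosure K Ω) ⟨x, hs⟩).symm.trans
      (congrArg Subtype.val this)
  · rintro ⟨hs, hx⟩
    have hs' := mem_separableClosure_iff.2 hs
    refine (IntermediateField.mem_lift (⟨x, hs'⟩ : separableClosure K Ω)).2 ?_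
    refine (mem_fixedField_iff _ _).2 fun σ hσ => Subtype.ext ?_
    have hc : ∀ y : separableClosure K Ω, σ.liftNormal Ω y = σ y := σ.liftNormal_commutes Ω
    refine (hc ⟨x, hs'⟩).symm.trans (hx _ ?_)
    refine map_eq_of_forall_separable wbar _ fun y hy => ?_
    exact (congrArg wbar (hc ⟨y, hy⟩)).trans (hσ ⟨y, hy⟩)

/-- For each `x`, the condition on `σ x` is closed when `K^sep` is discrete. Closedness lets the
infinite Galois correspondence recover the decomposition group from its fixed field `K^h`. -/
theorem isClosed_decompositionGroup [Algebra.IsAlgebraic K Ω] (wbar : Valuation Ω Θ) :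
    IsClosed (decompositionGroup K wbar : Set (separableClosure K Ω ≃ₐ[K] separableClosure K Ω)) := by
  let _ : TopologicalSpace (separableClosure K Ω) := ⊥
  have : DiscreteTopology (separableClosure K Ω) := ⟨rfl⟩
  have : ContinuousSMul (separableClosure K Ω ≃ₐ[K] separableClosure K Ω) (separableClosure K Ω) :=
    continuousSMul_iff_stabilizer_isOpen.2 fun x => stabilizer_isOpen_of_isIntegral x
  have : (decompositionGroup K wbar : Set (separableClosure K Ω ≃ₐ[K] separableClosure K Ω)) =
      ⋂ x : separableClosure K Ω, (fun σ => σ • x) ⁻¹' {y | wbar y = wbar x} := by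
    ext σ
    simp [decompositionGroup]
  rw [this]
  exact isClosed_iInter fun x => (isClosed_discrete _).preimage (by fun_prop)

theorem map_eq_of_fixes_henselization [Normal K Ω] (wbar : Valuation Ω Θ) (σ : Ω ≃ₐ[K] Ω)
    (h : ∀ x ∈ henselization K wbar, σ x = x) (y : Ω) : wbar (σ y) = wbar y := by
  have : Algebra.IsAlgebraic K Ω := Normal.toIsAlgebraic
  refine map_eq_of_forall_separable wbar _ (fun y hy => ?_) y
  have hfix : σ.restrictNormal (separableClosure K Ω) ∈ decompositionGroup K wbar := by
    have := InfiniteGalois.fixingSubgroup_fixedField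
      (⟨decompositionGroup K wbar, isClosed_decompositionGroup wbar⟩ : ClosedSubgroup _)
    change fixingSubgroup (fixedField (decompositionGroup K wbar)) = decompositionGroup K wbar at this
    rw [← this, IntermediateField.mem_fixingSubgroup_iff]
    intro x hx
    refine Subtype.ext ((σ.restrictNormal_commutes (separableClosure K Ω) x).trans ?_)
    exact h _ ((IntermediateField.mem_lift x).2 hx)
  rw [← hfix ⟨y, hy⟩]
  exact congrArg wbar (σ.restrictNormal_commutes (separableClosure K Ω) ⟨y, hy⟩).symm

instance isSeparable_henselization (wbar : Valuation Ω Θ) :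
    Algebra.IsSeparable K (henselization K wbar) :=
  (le_separableClosure_iff K Ω _).1 (IntermediateField.lift_le _)

end HenselizationBasic

section HenselizationTower
variable {K L Ω Θ : Type*} [Field K] [Field L] [Field Ω] [Algebra K L] [Algebra K Ω]
  [Algebra L Ω] [IsScalarTower K L Ω] [Normal K Ω] [LinearOrderedCommGroupWithZero Θ]

theorem henselization_le_henselization (wbar : Valuation Ω Θ) {x : Ω}
    (hx : x ∈ henselization K wbar) : x ∈ henselization L wbar := by
  have : Normal L Ω := Normal.tower_top_of_normal K L Ω
  obtain ⟨hs, h⟩ := (mem_henselization_iff wbar x).1 hx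
  exact (mem_henselization_iff wbar x).2
    ⟨hs.tower_top L, fun σ hσ => h (σ.restrictScalars K) hσ⟩

/-- Let `M = L K^h`. An element `x` of `L^h` outside `M` is separable over `M`, so some automorphism
over `M` moves it. That automorphism fixes `K^h`, hence is an isometry, and it fixes `L`; so it must
fix `x`. -/
theorem henselization_eq_adjoin (wbar : Valuation Ω Θ) :
    henselization L wbar = adjoin L (henselization K wbar : Set Ω) := by
  have : Normal L Ω := Normal.tower_top_of_normal K L Ω
  refine le_antisymm (fun x hx => ?_)
    (adjoin_le_iff.2 fun x hx => henselization_le_henselization wbar hx)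
  obtain ⟨hs, h⟩ := (mem_henselization_iff wbar x).1 hx
  set M := adjoin L (henselization K wbar : Set Ω)
  have hM : Normal M Ω := Normal.tower_top_of_normal L M Ω
  by_contra hxM
  have hsep : IsSeparable M x := hs.tower_top M
  obtain ⟨y, hy, hne⟩ : ∃ y : Ω, Polynomial.aeval y (minpoly M x) = 0 ∧ y ≠ x := by
    by_contra! hcon
    have hsplit := hM.splits x
    have hcard : (minpoly M x).natDegree = 1 := by
      rw [← Polynomial.card_rootSet_eq_natDegree hsep hsplit]
      refine Fintype.card_eq_one_iff.2 ⟨⟨x, ?_⟩, ?_⟩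
      · exact (Polynomial.mem_rootSet).2 ⟨minpoly.ne_zero hsep.isIntegral, minpoly.aeval _ _⟩
      · exact fun z => Subtype.ext (hcon _ (Polynomial.mem_rootSet.1 z.2).2)
    obtain ⟨z, hz⟩ := minpoly.natDegree_eq_one_iff.1 hcard
    exact hxM (hz ▸ z.2)
  obtain ⟨σ, hσ⟩ := minpoly.exists_algEquiv_of_root' (K := M) (hsep.isIntegral.isAlgebraic) hy
  refine hne (hσ.symm.trans ?_)
  refine h (σ.restrictScalars L) (map_eq_of_fixes_henselization wbar
    ((σ.restrictScalars L).restrictScalars K) fun z hz => ?_)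
  exact σ.commutes ⟨z, subset_adjoin L _ hz⟩

end HenselizationTower
end ValuedFieldExt

/-! ### Ramification, inertia and henselian degree inside `Ω`; multiplicativity in towers. -/

namespace ValuedFieldExt
open IntermediateField IsLocalRing

section ValueGroup
variable {K L Γ Δ : Type*} [Field K] [Field L] [Algebra K L]
  [LinearOrderedCommGroupWithZero Γ] [LinearOrderedCommGroupWithZero Δ]

theorem mem_valGroup_iff (w : Valuation L Δ) (y : Δˣ) : y ∈ valGroup w ↔ ∃ x, w x = y := by
  have h := MonoidWithZeroHom.valueMonoid_eq_valueGroup' (MonoidWithZeroHom.ofClass w)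
  rw [valGroup, ← SetLike.mem_coe, ← h]
  exact MonoidWithZeroHom.mem_valueMonoid_iff _

variable (K) in
/-- The elements of `Lˣ` whose value lies in the value group of `K`. -/
def unitsOfBaseValue (w : Valuation L Δ) : Subgroup Lˣ where
  carrier := {x | ∃ y : K, w (algebraMap K L y) = w x}
  one_mem' := ⟨1, by simp⟩
  mul_mem' := by
    rintro a b ⟨x, hx⟩ ⟨y, hy⟩
    exact ⟨x * y, by simp [hx, hy]⟩
  inv_mem' := by
    rintro a ⟨x, hx⟩
    exact ⟨x⁻¹, by simp [hx]⟩

/-- Pulling the value groups back along `w` expresses `e` through equalities of values only, so that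
it depends only on the equivalence class of `w`. -/
theorem ramIndex_eq_index (w : Valuation L Δ) : ramIndex K w = (unitsOfBaseValue K w).index := by
  have hr : (Units.map (w : L →* Δ)).range = valGroup w := by
    ext y
    rw [mem_valGroup_iff]
    constructor
    · rintro ⟨x, rfl⟩
      exact ⟨x, rfl⟩
    · rintro ⟨x, hx⟩
      have : x ≠ 0 := fun h => y.ne_zero (by rw [← hx, h, map_zero])
      exact ⟨Units.mk0 x this, Units.ext hx⟩
  have hc : (baseValGroup K w).comap (Units.map (w : L →* Δ)) = unitsOfBaseValue K w := by
    ext x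
    rw [Subgroup.mem_comap, baseValGroup, mem_valGroup_iff]
    rfl
  rw [ramIndex, ← hr, ← hc, Subgroup.index_comap]

theorem ramIndex_congr {w : Valuation L Γ} {w' : Valuation L Δ} (h : w.IsEquiv w') :
    ramIndex K w = ramIndex K w' := by
  rw [ramIndex_eq_index, ramIndex_eq_index]
  congr 1
  ext x
  exact exists_congr fun y => h.eq_iff

end ValueGroup

theorem finrank_eq_relfinrank {F E κ : Type*} [Field F] [Field E] [Field κ] [Algebra F E]
    (f : E →+* κ) : Module.finrank F E =
      Subfield.relfinrank (f.comp (algebraMap F E)).fieldRange f.fieldRange := by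
  have hc : (f.comp (algebraMap F E)).fieldRange.comap f = (algebraMap F E).fieldRange := by
    ext x
    simp [Subfield.mem_comap, RingHom.mem_fieldRange, f.injective.eq_iff]
  rw [← Subfield.finrank_comap, hc]
  exact Algebra.finrank_eq_of_equiv_equiv
    (RingEquiv.ofBijective (algebraMap F E).rangeRestrictField
      ⟨(algebraMap F E).rangeRestrictField.injective, (algebraMap F E).rangeRestrict_surjective⟩)
    (RingEquiv.refl E) (by ext; rfl)

section Residue
variable {K L Ω Γ Δ Θ : Type*} [Field K] [Field L] [Field Ω] [Algebra K L] [Algebra K Ω]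
  [Algebra L Ω] [IsScalarTower K L Ω] [LinearOrderedCommGroupWithZero Γ]
  [LinearOrderedCommGroupWithZero Δ] [LinearOrderedCommGroupWithZero Θ]

variable (K) in
/-- The residue field of `K`, as a subfield of the residue field of a valued extension `Ω`. -/
noncomputable def resField (wbar : Valuation Ω Θ) : Subfield (ResidueField wbar.valuationSubring) :=
  letI : (wbar.comap (algebraMap K Ω)).HasExtension wbar := ⟨.refl⟩
  (algebraMap (ResidueField (wbar.comap (algebraMap K Ω)).valuationSubring)
    (ResidueField wbar.valuationSubring)).fieldRange

theorem mem_resField_iff (wbar : Valuation Ω Θ) (x : ResidueField wbar.valuationSubring) :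
    x ∈ resField K wbar ↔ ∃ (a : K) (h : wbar (algebraMap K Ω a) ≤ 1),
      residue wbar.valuationSubring ⟨algebraMap K Ω a, h⟩ = x := by
  let _ : (wbar.comap (algebraMap K Ω)).HasExtension wbar := ⟨.refl⟩
  constructor
  · rintro ⟨y, rfl⟩
    obtain ⟨⟨a, ha⟩, rfl⟩ := residue_surjective y
    exact ⟨a, ha, rfl⟩
  · rintro ⟨a, h, rfl⟩
    exact ⟨residue _ ⟨a, h⟩, rfl⟩

theorem fieldRange_eq_resField (v : Valuation K Γ) (wbar : Valuation Ω Θ) [v.HasExtension wbar] :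
    (algebraMap (ResidueField v.valuationSubring)
      (ResidueField wbar.valuationSubring)).fieldRange = resField K wbar := by
  ext x
  rw [mem_resField_iff]
  constructor
  · rintro ⟨y, rfl⟩
    obtain ⟨⟨a, ha⟩, rfl⟩ := residue_surjective y
    exact ⟨a, (Valuation.HasExtension.val_map_le_one_iff v wbar a).2 ha, rfl⟩
  · rintro ⟨a, h, rfl⟩
    exact ⟨residue _ ⟨a, (Valuation.HasExtension.val_map_le_one_iff v wbar a).1 h⟩, rfl⟩

theorem hasExtension_trans (v : Valuation K Γ) (w : Valuation L Δ) (wbar : Valuation Ω Θ)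
    [v.HasExtension w] [w.HasExtension wbar] : v.HasExtension wbar := by
  constructor
  intro x y
  have h1 := Valuation.HasExtension.val_map_le_iff v w x y
  have h2 := Valuation.HasExtension.val_map_le_iff w wbar (algebraMap K L x) (algebraMap K L y)
  rw [← h1, ← h2]
  simp [IsScalarTower.algebraMap_apply K L Ω]

theorem inertiaDegree_eq_relfinrank (v : Valuation K Γ) (w : Valuation L Δ) (wbar : Valuation Ω Θ)
    [v.HasExtension w] [w.HasExtension wbar] :
    inertiaDegree v w = (resField K wbar).relfinrank (resField L wbar) := by
  have := hasExtension_trans v w wbar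
  rw [inertiaDegree, finrank_eq_relfinrank (algebraMap (ResidueField w.valuationSubring)
      (ResidueField wbar.valuationSubring)), fieldRange_eq_resField w wbar,
      ← fieldRange_eq_resField v wbar]
  congr 2
  ext x
  obtain ⟨⟨a, ha⟩, rfl⟩ := residue_surjective x
  refine congrArg (residue wbar.valuationSubring) (Subtype.ext ?_)
  exact (IsScalarTower.algebraMap_apply K L Ω a).symm

variable (K L) in
/-- The degree of henselizations of `L|K` with respect to a valuation of an extension field. -/
noncomputable def henselDegree (wbar : Valuation Ω Θ) : ℕ :=
  Subfield.relfinrank (henselization K wbar).toSubfield (henselization L wbar).toSubfield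

variable (K L) in
/-- The product of the ramification index and the inertia degree of `L|K` with respect to a
valuation of an extension field. -/
noncomputable def ramInertia (wbar : Valuation Ω Θ) : ℕ :=
  (valGroup (wbar.comap (algebraMap K Ω))).relIndex (valGroup (wbar.comap (algebraMap L Ω))) *
    (resField K wbar).relfinrank (resField L wbar)

theorem resField_mono (wbar : Valuation Ω Θ) : resField K wbar ≤ resField L wbar := by
  intro x
  rw [mem_resField_iff, mem_resField_iff]
  rintro ⟨a, h, rfl⟩
  refine ⟨algebraMap K L a, by rwa [← IsScalarTower.algebraMap_apply], ?_⟩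
  congr 2
  exact (IsScalarTower.algebraMap_apply K L Ω a).symm

theorem valGroup_comap_mono (wbar : Valuation Ω Θ) :
    valGroup (wbar.comap (algebraMap K Ω)) ≤ valGroup (wbar.comap (algebraMap L Ω)) := by
  intro x
  rw [mem_valGroup_iff, mem_valGroup_iff]
  rintro ⟨a, h⟩
  exact ⟨algebraMap K L a, by rw [← h]; simp [← IsScalarTower.algebraMap_apply]⟩

theorem comap_comap_algebraMap (wbar : Valuation Ω Θ) :
    (wbar.comap (algebraMap L Ω)).comap (algebraMap K L) = wbar.comap (algebraMap K Ω) := by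
  ext x
  simp [← IsScalarTower.algebraMap_apply]

theorem relIndex_valGroup_eq_ramIndex (w : Valuation L Δ) (wbar : Valuation Ω Θ)
    [hw : w.HasExtension wbar] :
    (valGroup (wbar.comap (algebraMap K Ω))).relIndex (valGroup (wbar.comap (algebraMap L Ω))) =
      ramIndex K w := by
  rw [ramIndex_congr (K := K) hw.val_isEquiv_comap, ramIndex, baseValGroup, comap_comap_algebraMap]

/-- After this, `v` and `w` disappear: both numbers are read off from `wbar` alone, and both
multiply in towers. -/
theorem defect_eq (v : Valuation K Γ) (w : Valuation L Δ) [v.HasExtension w]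
    (wbar : Valuation Ω Θ) [w.HasExtension wbar] :
    defect v w wbar = (henselDegree K L wbar : ℚ) / (ramInertia K L wbar : ℚ) := by
  rw [defect, ← relIndex_valGroup_eq_ramIndex w wbar, inertiaDegree_eq_relfinrank v w wbar,
    henselDegree, ramInertia, Nat.cast_mul]
  rfl

theorem ramInertia_mul {M : Type*} [Field M] [Algebra K M] [Algebra L M] [Algebra M Ω]
    [IsScalarTower K M Ω] [IsScalarTower L M Ω] (wbar : Valuation Ω Θ) :
    ramInertia K L wbar * ramInertia L M wbar = ramInertia K M wbar := by
  have h1 := Subgroup.relIndex_mul_relIndex _ _ _ (valGroup_comap_mono (K := K) (L := L) wbar)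
    (valGroup_comap_mono (K := L) (L := M) wbar)
  have h2 := Subfield.relfinrank_mul_relfinrank (resField_mono (K := K) (L := L) wbar)
    (resField_mono (K := L) (L := M) wbar)
  rw [ramInertia, ramInertia, ramInertia, ← h1, ← h2]
  ring

theorem henselDegree_mul [Normal K Ω] {M : Type*} [Field M] [Algebra K M] [Algebra L M]
    [Algebra M Ω] [IsScalarTower K M Ω] [IsScalarTower L M Ω] (wbar : Valuation Ω Θ) :
    henselDegree K L wbar * henselDegree L M wbar = henselDegree K M wbar := by
  have : Normal L Ω := Normal.tower_top_of_normal K L Ω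
  exact Subfield.relfinrank_mul_relfinrank
    (fun x hx => henselization_le_henselization (K := K) (L := L) wbar hx)
    (fun x hx => henselization_le_henselization (K := L) (L := M) wbar hx)

end Residue
end ValuedFieldExt

/-! ### Valuations centered on a Dedekind domain. -/

namespace ValuedFieldExt
open IntermediateField IsLocalRing IsDedekindDomain

section Center
variable {B E Δ : Type*} [CommRing B] [Field E] [Algebra B E] [LinearOrderedCommGroupWithZero Δ]

/-- The center on `B` of a valuation whose ring contains `B`. -/
def center (w : Valuation E Δ) (h : ∀ b : B, w (algebraMap B E b) ≤ 1) : Ideal B where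
  carrier := {b | w (algebraMap B E b) < 1}
  zero_mem' := by simp
  add_mem' := by
    intro a b ha hb
    change w (algebraMap B E (a + b)) < 1
    rw [map_add]
    exact w.map_add_lt ha hb
  smul_mem' := by
    intro a b hb
    change w (algebraMap B E (a * b)) < 1
    rw [map_mul, map_mul]
    exact (mul_le_of_le_one_left' (h a)).trans_lt hb

@[simp]
theorem mem_center {w : Valuation E Δ} {h : ∀ b : B, w (algebraMap B E b) ≤ 1} {b : B} :
    b ∈ center w h ↔ w (algebraMap B E b) < 1 := Iff.rfl

instance center_isPrime (w : Valuation E Δ) (h : ∀ b : B, w (algebraMap B E b) ≤ 1) :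
    (center w h).IsPrime := by
  refine ⟨fun h1 => ?_, fun {a b} hab => ?_⟩
  · have := (Ideal.eq_top_iff_one _).1 h1
    simp at this
  · by_contra! hcon
    simp only [mem_center, not_lt] at hcon hab
    have ha := le_antisymm (h a) hcon.1
    have hb := le_antisymm (h b) hcon.2
    rw [map_mul, map_mul, ha, hb, one_mul] at hab
    exact lt_irrefl _ hab

variable [IsDedekindDomain B]

/-- The center of a valuation, as a height one prime. -/
def centerSpectrum (w : Valuation E Δ) (h : ∀ b : B, w (algebraMap B E b) ≤ 1)
    (hne : center w h ≠ ⊥) : HeightOneSpectrum B := ⟨center w h, inferInstance, hne⟩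

/-- The valuation ring of `w` contains the localization of `B` at the center, a discrete valuation
ring, which has no larger proper overring; `w` is nontrivial because its center is nonzero. -/
theorem isEquiv_valuation_centerSpectrum [IsFractionRing B E] (w : Valuation E Δ)
    (h : ∀ b : B, w (algebraMap B E b) ≤ 1) (hne : center w h ≠ ⊥) :
    w.IsEquiv ((centerSpectrum w h hne).valuation E) := by
  set P := centerSpectrum w h hne
  have hle : (P.valuation E).valuationSubring ≤ w.valuationSubring := by
    intro x hx
    obtain ⟨n, ⟨d, hd⟩, hnd⟩ := P.exists_primeCompl_mul_eq_of_integer x hx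
    have hd1 : w (algebraMap B E d) = 1 := le_antisymm (h d) (not_lt.1 hd)
    have := congrArg w hnd
    rw [map_mul, hd1, mul_one] at this
    exact (Valuation.mem_valuationSubring_iff _ _).2 (this ▸ h n)
  have htop : w.valuationSubring ≠ ⊤ := by
    obtain ⟨b, hb, hb0⟩ := Submodule.exists_mem_ne_zero_of_ne_bot hne
    intro ht
    have hmem : (algebraMap B E b)⁻¹ ∈ w.valuationSubring := ht ▸ ValuationSubring.mem_top _
    rw [Valuation.mem_valuationSubring_iff, map_inv₀] at hmem
    have h0 : w (algebraMap B E b) ≠ 0 :=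
      (w.ne_zero_iff).2 ((map_ne_zero_iff _ (IsFractionRing.injective B E)).2 hb0)
    have := (inv_le_one₀ (zero_lt_iff.2 h0)).1 hmem
    exact absurd hb (not_lt.2 this)
  rw [Valuation.isEquiv_iff_valuationSubring, ← HeightOneSpectrum.valuationSubringAtPrime_eq_valuationSubring P] 
  rw [← HeightOneSpectrum.valuationSubringAtPrime_eq_valuationSubring P] at hle
  exact (ValuationSubring.eq_of_le_of_ne_top _ hle htop).symm

end Center

theorem valuation_le_one_of_isIntegral {A E Δ : Type*} [CommRing A] [Field E] [Algebra A E]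
    [LinearOrderedCommGroupWithZero Δ] (w : Valuation E Δ) (h : ∀ a : A, w (algebraMap A E a) ≤ 1)
    {x : E} (hx : IsIntegral A x) : w x ≤ 1 := by
  have := Valuation.Integers.mem_of_integral (v := w) (O := w.integer)
    (Valuation.integer.integers w) (x := x)
  let f : A →+* w.integer := (algebraMap A E).codRestrict w.integer h
  have hx' : IsIntegral w.integer x := by
    obtain ⟨p, hp, hpx⟩ := hx
    refine ⟨p.map f, hp.map f, ?_⟩
    rw [Polynomial.eval₂_map]
    exact hpx
  exact this hx'

section Ramification
variable {A K B L Ω Δ Θ : Type*} [CommRing A] [IsDedekindDomain A] [CommRing B] [IsDedekindDomain B]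
  [Algebra A B] [Module.IsTorsionFree A B]
  [Field K] [Field L] [Algebra K L] [Algebra A K] [IsFractionRing A K] [Algebra A L]
  [IsScalarTower A K L] [Algebra B L] [IsFractionRing B L] [IsScalarTower A B L]
  [LinearOrderedCommGroupWithZero Δ] [LinearOrderedCommGroupWithZero Θ]

/-- On `K` the `P`-adic valuation is the `e`-th power of the `v`-adic one. So the elements of `Lˣ`
with value in the value group of `K` form the kernel of the surjection onto `ℤ/e` given by the order
at `P` modulo `e`. -/
theorem ramIndex_eq_ramificationIdx (v : HeightOneSpectrum A) (P : HeightOneSpectrum B)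
    [P.asIdeal.LiesOver v.asIdeal] :
    ramIndex K (P.valuation L) = P.asIdeal.ramificationIdx A := by
  rw [← Ideal.ramificationIdx'_eq_ramificationIdx v.asIdeal P.asIdeal v.ne_bot, ramIndex_eq_index]
  have hv : ∀ y : K, P.valuation L (algebraMap K L y) =
    v.valuation K y ^ v.asIdeal.ramificationIdx' P.asIdeal := fun y =>
      (HeightOneSpectrum.valuation_liesOver L v P y).symm
  set e := v.asIdeal.ramificationIdx' P.asIdeal
  let ψ : Lˣ →* Multiplicative (ZMod e) :=
    { toFun := fun x => .ofAdd ((WithZero.log (P.valuation L x) : ℤ) : ZMod e)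
      map_one' := by simp
      map_mul' := by
        intro x y
        rw [Units.val_mul, map_mul, WithZero.log_mul (by simp) (by simp)]
        simp }
  have hψ : Function.Surjective ψ := by
    intro z
    obtain ⟨n, hn⟩ := ZMod.intCast_surjective z.toAdd
    obtain ⟨x, hx⟩ := P.valuation_surjective L (WithZero.exp n)
    have hx0 : x ≠ 0 := fun h0 => WithZero.exp_ne_zero (by rw [← hx, h0, map_zero])
    exact ⟨Units.mk0 x hx0, by simp [ψ, hx, hn]⟩
  have hker : unitsOfBaseValue K (P.valuation L) = ψ.ker := by
    ext x
    rw [MonoidHom.mem_ker]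
    change (∃ y : K, P.valuation L (algebraMap K L y) = P.valuation L x) ↔
      Multiplicative.ofAdd ((WithZero.log (P.valuation L x) : ℤ) : ZMod e) = 1
    rw [ofAdd_eq_one, ZMod.intCast_zmod_eq_zero_iff_dvd]
    constructor
    · rintro ⟨y, hy⟩
      rw [← hy, hv, WithZero.log_pow]
      simp
    · rintro ⟨n, hn⟩
      obtain ⟨y, hy⟩ := v.valuation_surjective K (WithZero.exp n)
      refine ⟨y, ?_⟩
      rw [hv, hy, ← WithZero.exp_nsmul, ← WithZero.exp_log (x := P.valuation L x) (by simp), hn]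
      simp
  rw [hker, Subgroup.index_ker, MonoidHom.range_eq_top.2 hψ]
  simp [Nat.card_congr Multiplicative.toAdd]

end Ramification

section Inertia
variable {B L Ω Θ : Type*} [CommRing B] [Field L] [Algebra B L] [Field Ω] [Algebra L Ω]
  [LinearOrderedCommGroupWithZero Θ]

/-- The reduction map of `B` to the residue field of a valuation whose ring contains `B`. -/
noncomputable def reduction (B L : Type*) [CommRing B] [Field L] [Algebra B L] [Algebra L Ω]
    (wbar : Valuation Ω Θ)
    (h : ∀ b : B, (wbar.comap (algebraMap L Ω)) (algebraMap B L b) ≤ 1) :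
    B →+* ResidueField wbar.valuationSubring :=
  (residue wbar.valuationSubring).comp
    (((algebraMap L Ω).comp (algebraMap B L)).codRestrict wbar.valuationSubring h)

theorem reduction_apply (wbar : Valuation Ω Θ)
    (h : ∀ b : B, (wbar.comap (algebraMap L Ω)) (algebraMap B L b) ≤ 1) (b : B) :
    reduction B L wbar h b =
      residue wbar.valuationSubring ⟨algebraMap L Ω (algebraMap B L b), h b⟩ := rfl

theorem residue_eq_iff (wbar : Valuation Ω Θ) (x y : wbar.valuationSubring) :
    residue wbar.valuationSubring x = residue wbar.valuationSubring y ↔ wbar (x - y : Ω) < 1 := by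
  rw [← sub_eq_zero, ← map_sub, residue_eq_zero_iff]
  exact Valuation.mem_maximalIdeal_iff _ wbar

theorem ker_reduction (wbar : Valuation Ω Θ)
    (h : ∀ b : B, (wbar.comap (algebraMap L Ω)) (algebraMap B L b) ≤ 1) :
    RingHom.ker (reduction B L wbar h) = center (wbar.comap (algebraMap L Ω)) h := by
  ext b
  rw [RingHom.mem_ker, reduction_apply, ← map_zero (residue _), residue_eq_iff]
  simp

/-- `B` is dense in the valuation ring of its center, so every residue class of `L` has a
representative in `B`. This identifies the residue field of `L` with `B` modulo the center. -/
theorem mem_resField_iff_reduction [IsDedekindDomain B] [IsFractionRing B L] (wbar : Valuation Ω Θ)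
    (h : ∀ b : B, (wbar.comap (algebraMap L Ω)) (algebraMap B L b) ≤ 1)
    (hne : center (wbar.comap (algebraMap L Ω)) h ≠ ⊥)
    (x : ResidueField wbar.valuationSubring) :
    x ∈ resField L wbar ↔ ∃ b, reduction B L wbar h b = x := by
  rw [mem_resField_iff]
  constructor
  · rintro ⟨a, ha, rfl⟩
    have heq := isEquiv_valuation_centerSpectrum (wbar.comap (algebraMap L Ω)) h hne
    set P := centerSpectrum _ h hne
    obtain ⟨b, hb⟩ := P.exists_valuation_sub_lt_of_integer (x := a) 
      ((Valuation.isEquiv_iff_val_le_one.1 heq).1 ha) 1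
    refine ⟨b, ?_⟩
    rw [reduction_apply, residue_eq_iff]
    have := (Valuation.isEquiv_iff_val_lt_one.1 heq).2 hb
    simpa using this
  · rintro ⟨b, rfl⟩
    exact ⟨algebraMap B L b, h b, rfl⟩

variable {A K : Type*} [CommRing A] [IsDedekindDomain A] [Field K] [Algebra A K] [IsFractionRing A K]
  [IsDedekindDomain B] [IsFractionRing B L] [Algebra A B] [Algebra K L] [Algebra A L]
  [IsScalarTower A K L] [IsScalarTower A B L] [Algebra K Ω] [IsScalarTower K L Ω]

theorem relfinrank_resField_eq_inertiaDeg (wbar : Valuation Ω Θ)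
    (hA : ∀ a : A, (wbar.comap (algebraMap K Ω)) (algebraMap A K a) ≤ 1)
    (hB : ∀ b : B, (wbar.comap (algebraMap L Ω)) (algebraMap B L b) ≤ 1)
    (hneA : center (wbar.comap (algebraMap K Ω)) hA ≠ ⊥)
    (hneB : center (wbar.comap (algebraMap L Ω)) hB ≠ ⊥)
    [hl : (center (wbar.comap (algebraMap L Ω)) hB).LiesOver
      (center (wbar.comap (algebraMap K Ω)) hA)] :
    (resField K wbar).relfinrank (resField L wbar) =
      (center (wbar.comap (algebraMap L Ω)) hB).inertiaDeg A := by
  have hkA := ker_reduction wbar hA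
  have hkB := ker_reduction wbar hB
  set p := center (wbar.comap (algebraMap K Ω)) hA
  set P := center (wbar.comap (algebraMap L Ω)) hB
  have : p.IsMaximal := Ideal.IsPrime.isMaximal inferInstance hneA
  have : P.IsMaximal := Ideal.IsPrime.isMaximal inferInstance hneB
  rw [Ideal.inertiaDeg_eq_of_isMaximal p P]
  let _ : Field (A ⧸ p) := Ideal.Quotient.field p
  let _ : Field (B ⧸ P) := Ideal.Quotient.field P
  let f : B ⧸ P →+* ResidueField wbar.valuationSubring :=
    Ideal.Quotient.lift P (reduction B L wbar hB) fun a ha => by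
      rwa [← RingHom.mem_ker, hkB]
  have hf : f.fieldRange = resField L wbar := by
    ext x
    rw [mem_resField_iff_reduction wbar hB hneB, RingHom.mem_fieldRange]
    constructor
    · rintro ⟨y, rfl⟩
      obtain ⟨b, rfl⟩ := Ideal.Quotient.mk_surjective y
      exact ⟨b, rfl⟩
    · rintro ⟨b, rfl⟩
      exact ⟨Ideal.Quotient.mk P b, rfl⟩
  have hfA : (f.comp (algebraMap (A ⧸ p) (B ⧸ P))).fieldRange = resField K wbar := by
    have hcomp : ∀ a : A, f (algebraMap (A ⧸ p) (B ⧸ P) (Ideal.Quotient.mk p a)) =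
        reduction A K wbar hA a := by
      intro a
      change reduction B L wbar hB (algebraMap A B a) = _
      rw [reduction_apply, reduction_apply]
      congr 2
      rw [← IsScalarTower.algebraMap_apply A B L, IsScalarTower.algebraMap_apply A K L,
        ← IsScalarTower.algebraMap_apply K L Ω]
    ext x
    rw [mem_resField_iff_reduction wbar hA hneA, RingHom.mem_fieldRange]
    constructor
    · rintro ⟨y, rfl⟩
      obtain ⟨b, rfl⟩ := Ideal.Quotient.mk_surjective y
      exact ⟨b, (hcomp b).symm⟩
    · rintro ⟨b, rfl⟩
      exact ⟨Ideal.Quotient.mk p b, hcomp b⟩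
  rw [finrank_eq_relfinrank f, hf, hfA]

variable [Module.IsTorsionFree A B] in
theorem ramInertia_eq (wbar : Valuation Ω Θ)
    (hA : ∀ a : A, (wbar.comap (algebraMap K Ω)) (algebraMap A K a) ≤ 1)
    (hB : ∀ b : B, (wbar.comap (algebraMap L Ω)) (algebraMap B L b) ≤ 1)
    (hneA : center (wbar.comap (algebraMap K Ω)) hA ≠ ⊥)
    (hneB : center (wbar.comap (algebraMap L Ω)) hB ≠ ⊥)
    [hl : (center (wbar.comap (algebraMap L Ω)) hB).LiesOver
      (center (wbar.comap (algebraMap K Ω)) hA)] :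
    ramInertia K L wbar = (center (wbar.comap (algebraMap L Ω)) hB).ramificationIdx A *
      (center (wbar.comap (algebraMap L Ω)) hB).inertiaDeg A := by
  have heq := isEquiv_valuation_centerSpectrum (wbar.comap (algebraMap L Ω)) hB hneB
  have : (wbar.comap (algebraMap L Ω)).HasExtension wbar := ⟨.refl⟩
  have : (centerSpectrum _ hB hneB).asIdeal.LiesOver (centerSpectrum _ hA hneA).asIdeal := hl
  rw [ramInertia, relfinrank_resField_eq_inertiaDeg wbar hA hB hneA hneB,
    relIndex_valGroup_eq_ramIndex (wbar.comap (algebraMap L Ω)) wbar, ramIndex_congr heq,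
    ramIndex_eq_ramificationIdx (centerSpectrum _ hA hneA) (centerSpectrum _ hB hneB)]
  rfl

end Inertia
end ValuedFieldExt

/-! ### The fundamental identity in the purely inseparable and Galois cases. -/

namespace ValuedFieldExt
open IntermediateField IsLocalRing IsDedekindDomain
open scoped Pointwise

/-- If `w (σ x)` differed from `w x`, the values along the orbit of `x` would be strictly monotone,
but the orbit lies in the finite root set of `minpoly K x`. Centers determine a valuation only up to
equivalence; this upgrades equivalence to equality. -/
theorem map_eq_of_map_le_map_iff {K E Δ : Type*} [Field K] [Field E] [Algebra K E]
    [LinearOrderedCommGroupWithZero Δ] [Algebra.IsAlgebraic K E] (w : Valuation E Δ)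
    (σ : E ≃ₐ[K] E) (h : ∀ x y, w (σ x) ≤ w (σ y) ↔ w x ≤ w y) (x : E) : w (σ x) = w x := by
  have hlt : ∀ x y, w (σ x) < w (σ y) ↔ w x < w y := fun x y => by
    rw [← not_le, ← not_le, h]
  have hm : ∀ n : ℕ, (σ ^ n) x ∈ (minpoly K x).rootSet E := by
    intro n
    refine Polynomial.mem_rootSet.2 ⟨minpoly.ne_zero (Algebra.IsIntegral.isIntegral x), ?_⟩
    rw [Polynomial.aeval_algHom_apply, minpoly.aeval, map_zero]
  obtain ⟨m, n, hmn, he⟩ := Finite.exists_ne_map_eq_of_infinite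
    (fun n : ℕ => (⟨(σ ^ n) x, hm n⟩ : (minpoly K x).rootSet E))
  replace he : (σ ^ m) x = (σ ^ n) x := congrArg Subtype.val he
  have hs : ∀ n, (σ ^ (n + 1)) x = σ ((σ ^ n) x) := fun n => by rw [pow_succ']; rfl
  by_contra hne
  rcases lt_or_gt_of_ne hne with hlt1 | hgt1
  · have : StrictAnti fun n : ℕ => w ((σ ^ n) x) := by
      refine strictAnti_nat_of_succ_lt fun n => ?_
      induction n with
      | zero => simpa using hlt1
      | succ n ih => rw [hs (n + 1), hs n] at *; exact (hlt _ _).2 ih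
    exact hmn (this.injective (congrArg w he))
  · have : StrictMono fun n : ℕ => w ((σ ^ n) x) := by
      refine strictMono_nat_of_lt_succ fun n => ?_
      induction n with
      | zero => simpa using hgt1
      | succ n ih => rw [hs (n + 1), hs n] at *; exact (hlt _ _).2 ih
    exact hmn (this.injective (congrArg w he))

theorem isEquiv_of_center_eq {B E Δ Δ' : Type*} [CommRing B] [IsDedekindDomain B] [Field E]
    [Algebra B E] [IsFractionRing B E] [LinearOrderedCommGroupWithZero Δ]
    [LinearOrderedCommGroupWithZero Δ'] (w : Valuation E Δ) (w' : Valuation E Δ')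
    (h : ∀ b : B, w (algebraMap B E b) ≤ 1) (h' : ∀ b : B, w' (algebraMap B E b) ≤ 1)
    (hne : center w h ≠ ⊥) (heq : center w h = center w' h') : w.IsEquiv w' := by
  have hs : centerSpectrum w h hne = centerSpectrum w' h' (heq ▸ hne) :=
    HeightOneSpectrum.ext heq
  exact (isEquiv_valuation_centerSpectrum w h hne).trans
    (hs ▸ (isEquiv_valuation_centerSpectrum w' h' (heq ▸ hne)).symm)

/-- The automorphisms of `L|K` preserving a valuation of `L`. -/
def isometryGroup (K : Type*) {L Δ : Type*} [Field K] [Field L] [Algebra K L]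
    [LinearOrderedCommGroupWithZero Δ] (w : Valuation L Δ) : Subgroup (L ≃ₐ[K] L) where
  carrier := {σ | ∀ x, w (σ x) = w x}
  one_mem' := fun _ => rfl
  mul_mem' := fun {σ τ} hσ hτ x => (hσ (τ x)).trans (hτ x)
  inv_mem' := fun {σ} hσ x => by
    have h := hσ (σ⁻¹ x)
    rw [← AlgEquiv.mul_apply, mul_inv_cancel, AlgEquiv.one_apply] at h
    exact h.symm

section FundamentalIdentity
variable {A K L Ω Θ : Type*} [CommRing A] [IsDedekindDomain A] [Field K] [Field L] [Algebra K L]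
  [Algebra A K] [IsFractionRing A K] [Algebra A L] [IsScalarTower A K L]
  [Field Ω] [Algebra K Ω] [Algebra L Ω] [IsScalarTower K L Ω] [LinearOrderedCommGroupWithZero Θ]

/-- Finiteness over `A` supplies noetherianity, so inseparable `L|K` are covered. -/
theorem isDedekindDomain_integralClosure (K : Type*) [Field K] [Algebra K L] [Algebra A K]
    [IsFractionRing A K] [IsScalarTower A K L] [FiniteDimensional K L]
    [Module.Finite A (integralClosure A L)] : IsDedekindDomain (integralClosure A L) := by
  have h1 := integralClosure.isIntegrallyClosedOfFiniteExtension (R := A) K (L := L)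
  have h2 : IsNoetherianRing (integralClosure A L) :=
    isNoetherian_of_tower A (isNoetherian_of_isNoetherianRing_of_finite A _)
  exact { h1, h2 with maximalOfPrime := (Ring.DimensionLEOne.integralClosure A L).maximalOfPrime }

variable (A) in
/-- The valuation ring of `wbar` contains `A` and its maximal ideal meets `A` nontrivially. -/
structure IsCentered [Algebra A Ω] (wbar : Valuation Ω Θ) : Prop where
  le_one : ∀ a : A, wbar (algebraMap A Ω a) ≤ 1
  exists_lt_one : ∃ a : A, algebraMap A Ω a ≠ 0 ∧ wbar (algebraMap A Ω a) < 1

variable [Algebra A Ω] [IsScalarTower A K Ω] [IsScalarTower A L Ω]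

omit [IsDedekindDomain A] [IsFractionRing A K] in
theorem IsCentered.comap_le_one {wbar : Valuation Ω Θ} (hc : IsCentered A wbar) (a : A) :
    (wbar.comap (algebraMap K Ω)) (algebraMap A K a) ≤ 1 := by
  rw [Valuation.comap_apply, ← IsScalarTower.algebraMap_apply]
  exact hc.le_one a

omit [IsDedekindDomain A] in
theorem IsCentered.comap_integralClosure_le_one {wbar : Valuation Ω Θ} (hc : IsCentered A wbar)
    (b : integralClosure A L) :
    (wbar.comap (algebraMap L Ω)) (algebraMap (integralClosure A L) L b) ≤ 1 :=
  valuation_le_one_of_isIntegral _ (fun a => by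
    rw [Valuation.comap_apply, ← IsScalarTower.algebraMap_apply]
    exact hc.le_one a) b.2

omit [IsDedekindDomain A] [IsFractionRing A K] in
theorem IsCentered.center_ne_bot {wbar : Valuation Ω Θ} (hc : IsCentered A wbar) :
    center _ (hc.comap_le_one (K := K)) ≠ ⊥ := by
  obtain ⟨a, ha, hlt⟩ := hc.exists_lt_one
  intro h
  have : a ∈ center _ (hc.comap_le_one (K := K)) := by
    rw [mem_center, Valuation.comap_apply, ← IsScalarTower.algebraMap_apply]
    exact hlt
  rw [h, Ideal.mem_bot] at this
  exact ha (by rw [this, map_zero])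

omit [IsDedekindDomain A] in
theorem IsCentered.center_integralClosure_ne_bot {wbar : Valuation Ω Θ} (hc : IsCentered A wbar) :
    center _ (hc.comap_integralClosure_le_one (L := L)) ≠ ⊥ := by
  obtain ⟨a, ha, hlt⟩ := hc.exists_lt_one
  intro h
  have : algebraMap A _ a ∈ center _ (hc.comap_integralClosure_le_one (L := L)) := by
    rw [mem_center, Valuation.comap_apply, ← IsScalarTower.algebraMap_apply,
      ← IsScalarTower.algebraMap_apply]
    exact hlt
  rw [h, Ideal.mem_bot] at this
  refine ha ?_
  rw [IsScalarTower.algebraMap_apply A L Ω, IsScalarTower.algebraMap_apply A (integralClosure A L) L,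
    this, map_zero, map_zero]

variable [FiniteDimensional K L] [Module.Finite A (integralClosure A L)]

theorem ramInertia_eq_of_isCentered (wbar : Valuation Ω Θ) (hc : IsCentered A wbar) :
    ramInertia K L wbar =
      (center _ (hc.comap_integralClosure_le_one (L := L))).ramificationIdx A *
      (center _ (hc.comap_integralClosure_le_one (L := L))).inertiaDeg A := by
  have := isDedekindDomain_integralClosure (A := A) (L := L) K
  have := integralClosure.isFractionRing_of_finite_extension (A := A) K L
  have hl : (center _ (hc.comap_integralClosure_le_one (L := L))).LiesOver
      (center _ (hc.comap_le_one (K := K))) := by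
    constructor
    ext a
    simp [← IsScalarTower.algebraMap_apply]
  have : FaithfulSMul A L := (faithfulSMul_iff_algebraMap_injective A L).2 (by
    rw [IsScalarTower.algebraMap_eq A K L]
    exact (algebraMap K L).injective.comp (IsFractionRing.injective A K))
  exact ramInertia_eq wbar hc.comap_le_one _ hc.center_ne_bot hc.center_integralClosure_ne_bot

/-- Every element of the integral closure has a power in `A`, so a prime is determined by its
contraction to `A`. Only one prime lies over the center, and `∑ e f = n` has a single term. -/
theorem ramInertia_eq_finrank [IsPurelyInseparable K L] (wbar : Valuation Ω Θ)
    (hc : IsCentered A wbar) : ramInertia K L wbar = Module.finrank K L := by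
  have := isDedekindDomain_integralClosure (A := A) (L := L) K
  have := integralClosure.isFractionRing_of_finite_extension (A := A) K L
  have hl : (center _ (hc.comap_integralClosure_le_one (L := L))).LiesOver
      (center _ (hc.comap_le_one (K := K))) := by
    constructor
    ext a
    simp [← IsScalarTower.algebraMap_apply]
  have : FaithfulSMul A L := (faithfulSMul_iff_algebraMap_injective A L).2 (by
    rw [IsScalarTower.algebraMap_eq A K L]
    exact (algebraMap K L).injective.comp (IsFractionRing.injective A K))
  rw [ramInertia_eq_of_isCentered wbar hc]
  set p := center _ (hc.comap_le_one (K := K))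
  set P := center _ (hc.comap_integralClosure_le_one (L := L))
  have hpow : ∀ b : integralClosure A L, ∃ (n : ℕ) (a : A), n ≠ 0 ∧ b ^ n = algebraMap A _ a := by
    intro b
    obtain ⟨q, _⟩ := ExpChar.exists K
    obtain ⟨n, y, hy⟩ := IsPurelyInseparable.pow_mem K q (b : L)
    have hint : IsIntegral A y := by
      refine (isIntegral_algHom_iff (IsScalarTower.toAlgHom A K L) (algebraMap K L).injective).1 ?_
      change IsIntegral A (algebraMap K L y)
      rw [hy]
      exact b.2.pow _
    obtain ⟨a, rfl⟩ := IsIntegrallyClosed.isIntegral_iff.1 hint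
    refine ⟨q ^ n, a, (expChar_pow_pos K q n).ne', Subtype.ext ?_⟩
    rw [SubmonoidClass.coe_pow, ← hy, ← IsScalarTower.algebraMap_apply A K L]
    rfl
  have huniq : ∀ Q : p.primesOver (integralClosure A L), Q.1 = P := by
    rintro ⟨Q, hQ, hQp⟩
    ext b
    obtain ⟨n, a, hn, hb⟩ := hpow b
    rw [← hQ.pow_mem_iff_mem n (Nat.pos_of_ne_zero hn),
      ← (center_isPrime _ _ : P.IsPrime).pow_mem_iff_mem n (Nat.pos_of_ne_zero hn), hb,
      ← Ideal.mem_comap, ← Ideal.mem_comap]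
    change a ∈ Q.under A ↔ a ∈ P.under A
    rw [← hQp.over, ← hl.over]
  let _ : Unique (p.primesOver (integralClosure A L)) :=
    { default := ⟨P, inferInstance, hl⟩
      uniq := fun Q => Subtype.ext (huniq Q) }
  have hsum := Ideal.sum_ramification_inertia_eq_finrank (S := integralClosure A L) p
  rw [Fintype.sum_unique] at hsum
  exact hsum.trans (IsFractionRing.finrank_eq A K (integralClosure A L) L).symm

/-- The isometry group is the stabilizer of the center `P`. With `g` the size of the orbit of `P`,
both `g e f` and `g` times the order of the stabilizer equal the order of the Galois group. -/
theorem ramInertia_eq_card [IsGalois K L] (wbar : Valuation Ω Θ) (hc : IsCentered A wbar) :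
    ramInertia K L wbar = Nat.card (isometryGroup K (wbar.comap (algebraMap L Ω))) := by
  have := isDedekindDomain_integralClosure (A := A) (L := L) K
  have := integralClosure.isFractionRing_of_finite_extension (A := A) K L
  have hl : (center _ (hc.comap_integralClosure_le_one (L := L))).LiesOver
      (center _ (hc.comap_le_one (K := K))) := by
    constructor
    ext a
    simp [← IsScalarTower.algebraMap_apply]
  have : FaithfulSMul A L := (faithfulSMul_iff_algebraMap_injective A L).2 (by
    rw [IsScalarTower.algebraMap_eq A K L]
    exact (algebraMap K L).injective.comp (IsFractionRing.injective A K))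
  have hne := hc.center_integralClosure_ne_bot (L := L)
  rw [ramInertia_eq_of_isCentered wbar hc]
  set p := center _ (hc.comap_le_one (K := K))
  set P := center _ (hc.comap_integralClosure_le_one (L := L))
  let _ : MulSemiringAction Gal(L/K) (integralClosure A L) :=
    IsIntegralClosure.MulSemiringAction A K L (integralClosure A L)
  have : IsGaloisGroup Gal(L/K) A (integralClosure A L) := IsGaloisGroup.of_isFractionRing _ _ _ K L
  have hsmul : ∀ (σ : Gal(L/K)) (b : integralClosure A L), ((σ • b : integralClosure A L) : L) = σ b :=
    fun σ b => algebraMap_galRestrict_apply A σ b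
  have hstab : MulAction.stabilizer Gal(L/K) P = isometryGroup K (wbar.comap (algebraMap L Ω)) := by
    ext σ
    rw [MulAction.mem_stabilizer_iff]
    constructor
    · intro hσ
      have hmem : ∀ b, σ • b ∈ P ↔ b ∈ P := fun b => by
        conv_lhs => rw [← hσ]
        exact Ideal.smul_mem_pointwise_smul_iff
      have heq := isEquiv_of_center_eq (B := integralClosure A L) (wbar.comap (algebraMap L Ω))
        ((wbar.comap (algebraMap L Ω)).comap (σ : L →+* L)) hc.comap_integralClosure_le_one
        (fun b => by
          have := hc.comap_integralClosure_le_one (σ • b)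
          rwa [show algebraMap (integralClosure A L) L (σ • b) = σ b from hsmul σ b] at this)
        hne (by
          ext b
          rw [← hmem b]
          change wbar (algebraMap L Ω ((σ • b : integralClosure A L) : L)) < 1 ↔
            wbar (algebraMap L Ω (σ b)) < 1
          rw [hsmul])
      exact map_eq_of_map_le_map_iff _ σ fun x y => (heq x y).symm
    · intro hσ
      ext b
      have hσ' : σ⁻¹ ∈ isometryGroup K (wbar.comap (algebraMap L Ω)) := inv_mem hσ
      rw [Ideal.mem_pointwise_smul_iff_inv_smul_mem]
      change wbar (algebraMap L Ω ((σ⁻¹ • b : integralClosure A L) : L)) < 1 ↔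
            wbar (algebraMap L Ω b) < 1
      rw [hsmul]
      exact (hσ' b) ▸ Iff.rfl
  rw [← hstab]
  have h1 := Ideal.ncard_primesOver_mul_ramificationIdxIn_mul_inertiaDegIn p (integralClosure A L)
    Gal(L/K)
  rw [Ideal.ramificationIdxIn_eq_ramificationIdx p P Gal(L/K),
    Ideal.inertiaDegIn_eq_inertiaDeg p P Gal(L/K),
    ← Algebra.IsInvariant.orbit_eq_primesOver A (integralClosure A L) Gal(L/K) p P] at h1
  have h2 := Nat.card_congr (MulAction.orbitProdStabilizerEquivGroup Gal(L/K) P)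
  rw [Nat.card_prod, ← h1, Nat.card_coe_set_eq] at h2
  have hpos : (MulAction.orbit Gal(L/K) P).ncard ≠ 0 := fun h0 => by
    rw [h0, zero_mul] at h1
    exact Nat.card_pos.ne h1
  exact (mul_left_cancel₀ hpos h2).symm

end FundamentalIdentity

/-- `E` may be infinite over `K`, so the comparison is made on each `K(x)`, where the integral
closure of `A` is Dedekind and the center determines the valuation. -/
theorem isEquiv_of_forall_isIntegral {A K E Δ Δ' : Type*} [CommRing A] [IsDedekindDomain A]
    [Field K] [Field E] [Algebra K E] [Algebra A K] [IsFractionRing A K] [Algebra A E]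
    [IsScalarTower A K E] [LinearOrderedCommGroupWithZero Δ] [LinearOrderedCommGroupWithZero Δ']
    [Algebra.IsSeparable K E] (w : Valuation E Δ) (w' : Valuation E Δ')
    (hle : ∀ a : A, w (algebraMap A E a) ≤ 1) (hle' : ∀ a : A, w' (algebraMap A E a) ≤ 1)
    (hne : ∃ a : A, algebraMap A E a ≠ 0 ∧ w (algebraMap A E a) < 1)
    (h : ∀ x : E, IsIntegral A x → (w x < 1 ↔ w' x < 1)) : w.IsEquiv w' := by
  rw [Valuation.isEquiv_iff_val_le_one]
  intro x
  have : FiniteDimensional K K⟮x⟯ := adjoin.finiteDimensional (Algebra.IsIntegral.isIntegral x)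
  have := integralClosure.isDedekindDomain A K K⟮x⟯
  have := integralClosure.isFractionRing_of_finite_extension (A := A) K K⟮x⟯
  have : IsScalarTower A K⟮x⟯ E := .of_algebraMap_eq fun a => by
    rw [IsScalarTower.algebraMap_apply A K K⟮x⟯, ← IsScalarTower.algebraMap_apply K K⟮x⟯ E,
      ← IsScalarTower.algebraMap_apply A K E]
  have hint : ∀ b : integralClosure A K⟮x⟯, IsIntegral A ((b : K⟮x⟯) : E) := fun b =>
    b.2.map (IsScalarTower.toAlgHom A K⟮x⟯ E)
  have := isEquiv_of_center_eq (B := integralClosure A K⟮x⟯) (w.comap (algebraMap K⟮x⟯ E))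
    (w'.comap (algebraMap K⟮x⟯ E))
    (fun b => valuation_le_one_of_isIntegral w hle (hint b))
    (fun b => valuation_le_one_of_isIntegral w' hle' (hint b))
    (fun hbot => by
      obtain ⟨a, ha, hlt⟩ := hne
      have : algebraMap A (integralClosure A K⟮x⟯) a = 0 := (Ideal.mem_bot).1 (hbot ▸ hlt)
      exact ha (congrArg (fun b : integralClosure A K⟮x⟯ => ((b : K⟮x⟯) : E)) this))
    (Ideal.ext fun b => h _ (hint b))
  exact Valuation.isEquiv_iff_val_le_one.1 this (x := AdjoinSimple.gen K x)

end ValuedFieldExt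

/-! ### Conjugacy of extensions of a valuation, and lifting of isometries. -/

namespace ValuedFieldExt
open IntermediateField IsLocalRing IsDedekindDomain
open scoped Pointwise

section Conjugacy
variable {A K Ω Θ : Type*} [CommRing A] [IsDedekindDomain A] [Field K]
  [Algebra A K] [IsFractionRing A K] [Field Ω] [Algebra K Ω] [Algebra A Ω] [IsScalarTower A K Ω]
  [LinearOrderedCommGroupWithZero Θ] [Normal K Ω]

/-- Valuations of a normal extension with the same center on the base are conjugate. -/
theorem exists_algEquiv_map_le_map_iff (K : Type*) [Field K] [Algebra A K] [IsFractionRing A K]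
    [Algebra K Ω] [IsScalarTower A K Ω] [Normal K Ω] (w w' : Valuation Ω Θ) (hw : IsCentered A w)
    (hw' : IsCentered A w')
    (h : ∀ a : A, w (algebraMap A Ω a) < 1 ↔ w' (algebraMap A Ω a) < 1) :
    ∃ τ : Ω ≃ₐ[K] Ω, ∀ x y, w' (τ x) ≤ w' (τ y) ↔ w x ≤ w y := by
  have : Algebra.IsAlgebraic K Ω := Normal.toIsAlgebraic
  set E := separableClosure K Ω with hE
  have : IsScalarTower A E Ω := .of_algebraMap_eq fun a => by
    rw [IsScalarTower.algebraMap_apply A K E, ← IsScalarTower.algebraMap_apply K E Ω,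
      ← IsScalarTower.algebraMap_apply A K Ω]
  let C := integralClosure A E
  let _ : MulSemiringAction Gal(E/K) C := IsIntegralClosure.MulSemiringAction A K E C
  have hsmul : ∀ (σ : Gal(E/K)) (b : C), ((σ • b : C) : E) = σ b :=
    fun σ b => algebraMap_galRestrict_apply A σ b
  have : SMulCommClass Gal(E/K) A C := ⟨fun σ a c => Subtype.ext (by
    rw [hsmul]
    change σ (a • (c : E)) = a • ((σ • c : C) : E)
    rw [hsmul, ← IsScalarTower.algebraMap_smul K, map_smul, IsScalarTower.algebraMap_smul])⟩
  have : Algebra.IsInvariant A C Gal(E/K) := ⟨fun c hc => by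
    obtain ⟨y, hy⟩ := (InfiniteGalois.mem_range_algebraMap_iff_fixed (k := K) (c : E)).2
      fun σ => (hsmul σ c).symm.trans (congrArg Subtype.val (hc σ))
    have hint : IsIntegral A y :=
      (isIntegral_algHom_iff (IsScalarTower.toAlgHom A K E) (algebraMap K E).injective).1
        (show IsIntegral A (algebraMap K E y) from hy ▸ c.2)
    obtain ⟨a, rfl⟩ := IsIntegrallyClosed.isIntegral_iff.1 hint
    exact ⟨a, Subtype.ext (by rw [← hy, ← IsScalarTower.algebraMap_apply A K E]; rfl)⟩⟩
  let _ : TopologicalSpace C := ⊥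
  have : DiscreteTopology C := ⟨rfl⟩
  have hst : ∀ c : C, MulAction.stabilizer Gal(E/K) c = MulAction.stabilizer Gal(E/K) (c : E) := by
    intro c
    ext σ
    change σ • c = c ↔ σ (c : E) = c
    rw [← hsmul, Subtype.ext_iff]
  have : ContinuousSMul Gal(E/K) C := continuousSMul_iff_stabilizer_isOpen.2 fun c => by
    rw [hst]
    exact stabilizer_isOpen_of_isIntegral (K := K) (c : E)
  have hA : ∀ v : Valuation Ω Θ, IsCentered A v → ∀ a : A,
      (v.comap (algebraMap E Ω)) (algebraMap A E a) ≤ 1 := fun v hv a => by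
    rw [Valuation.comap_apply, ← IsScalarTower.algebraMap_apply]
    exact hv.le_one a
  have hC : ∀ b : C, (w.comap (algebraMap E Ω)) (algebraMap C E b) ≤ 1 := fun b =>
    valuation_le_one_of_isIntegral _ (hA w hw) b.2
  have hC' : ∀ b : C, (w'.comap (algebraMap E Ω)) (algebraMap C E b) ≤ 1 := fun b =>
    valuation_le_one_of_isIntegral _ (hA w' hw') b.2
  -- The profinite Galois group permutes transitively the primes of `C` over a given prime of `A`;
  -- the discrete topology on `C` above serves to make the action continuous.
  obtain ⟨g, hg⟩ := Algebra.IsInvariant.exists_smul_of_under_eq_of_profinite (A := A) (G := Gal(E/K))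
    (center (B := C) (w.comap (algebraMap E Ω)) hC) (center (B := C) (w'.comap (algebraMap E Ω)) hC')
    (Ideal.ext fun a => h a)
  have hequiv : (w.comap (algebraMap E Ω)).IsEquiv
      ((w'.comap (algebraMap E Ω)).comap (g : E →+* E)) := by
    refine isEquiv_of_forall_isIntegral (A := A) (K := K) _ _ (hA w hw) (fun a => ?_) ?_ ?_
    · change w' (algebraMap E Ω (g (algebraMap A E a))) ≤ 1
      rw [IsScalarTower.algebraMap_apply A K E, g.commutes, ← IsScalarTower.algebraMap_apply A K E]
      exact hA w' hw' a
    · obtain ⟨a, ha, hlt⟩ := hw.exists_lt_one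
      refine ⟨a, fun h0 => ha ?_, ?_⟩
      · rw [IsScalarTower.algebraMap_apply A E Ω, h0, map_zero]
      · rwa [Valuation.comap_apply, ← IsScalarTower.algebraMap_apply]
    · intro x hx
      have := Ideal.smul_mem_pointwise_smul_iff (a := g) (x := (⟨x, hx⟩ : C))
        (S := center (B := C) (w.comap (algebraMap E Ω)) hC)
      rw [← hg] at this
      change w' (algebraMap E Ω ((g • (⟨x, hx⟩ : C) : C) : E)) < 1 ↔ w (algebraMap E Ω x) < 1 at this
      rw [hsmul] at this
      exact this.symm
  refine ⟨g.liftNormal Ω, fun x y => ?_⟩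
  obtain ⟨m, hm, hx⟩ := exists_pow_mem_separableClosure K x
  obtain ⟨n, hn, hy⟩ := exists_pow_mem_separableClosure K y
  have hmn : m * n ≠ 0 := mul_ne_zero hm hn
  have hx' : x ^ (m * n) ∈ E := by rw [pow_mul]; exact pow_mem hx n
  have hy' : y ^ (m * n) ∈ E := by rw [mul_comm, pow_mul]; exact pow_mem hy m
  have key := hequiv ⟨_, hx'⟩ ⟨_, hy'⟩
  have hcx : g.liftNormal Ω (x ^ (m * n)) = algebraMap E Ω (g ⟨_, hx'⟩) :=
    g.liftNormal_commutes Ω ⟨_, hx'⟩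
  have hcy : g.liftNormal Ω (y ^ (m * n)) = algebraMap E Ω (g ⟨_, hy'⟩) :=
    g.liftNormal_commutes Ω ⟨_, hy'⟩
  change w (x ^ (m * n)) ≤ w (y ^ (m * n)) ↔
    w' (algebraMap E Ω (g ⟨_, hx'⟩)) ≤ w' (algebraMap E Ω (g ⟨_, hy'⟩)) at key
  rw [← hcx, ← hcy] at key
  simp only [map_pow] at key
  rw [pow_le_pow_iff_left₀ zero_le zero_le hmn, pow_le_pow_iff_left₀ zero_le zero_le hmn] at key
  exact key.symm

end Conjugacy

/-- An automorphism of a normal subextension which preserves the valuation extends to one of the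
whole extension which preserves the valuation. -/
theorem exists_isometry_lift {K B L Ω Θ : Type*} [Field K] [CommRing B] [IsDedekindDomain B] [Field L]
    [Algebra K L] [Algebra B L] [IsFractionRing B L] [Field Ω] [Algebra K Ω] [Algebra L Ω]
    [Algebra B Ω] [IsScalarTower B L Ω] [IsScalarTower K L Ω] [Normal K Ω]
    [LinearOrderedCommGroupWithZero Θ] (wbar : Valuation Ω Θ) (hc : IsCentered B wbar)
    (σ : L ≃ₐ[K] L) (hσ : σ ∈ isometryGroup K (wbar.comap (algebraMap L Ω))) :
    ∃ τ : Ω ≃ₐ[K] Ω, (∀ x, wbar (τ x) = wbar x) ∧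
      ∀ x, τ (algebraMap L Ω x) = algebraMap L Ω (σ x) := by
  have : Algebra.IsAlgebraic K Ω := Normal.toIsAlgebraic
  have : Normal L Ω := Normal.tower_top_of_normal K L Ω
  have hcomm : ∀ x, σ.liftNormal Ω (algebraMap L Ω x) = algebraMap L Ω (σ x) :=
    σ.liftNormal_commutes Ω
  have heq : ∀ b : B, wbar (σ.liftNormal Ω (algebraMap B Ω b)) = wbar (algebraMap B Ω b) := by
    intro b
    rw [IsScalarTower.algebraMap_apply B L Ω, hcomm]
    exact hσ _
  -- An arbitrary lift of `σ` need not preserve `wbar`, but the pullback of `wbar` along it has the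
  -- same center on `B`. The two valuations are thus conjugate over `L`, and composing with the
  -- conjugating map corrects the lift.
  obtain ⟨τ, hτ⟩ := exists_algEquiv_map_le_map_iff (A := B) L wbar
    (wbar.comap (σ.liftNormal Ω : Ω →+* Ω)) hc
    ⟨fun b => (heq b).trans_le (hc.le_one b), by
      obtain ⟨b, hb, hlt⟩ := hc.exists_lt_one
      exact ⟨b, hb, (heq b).trans_lt hlt⟩⟩
    (fun b => by rw [← heq b]; rfl)
  refine ⟨(τ.restrictScalars K).trans (σ.liftNormal Ω), ?_, fun x => ?_⟩
  · exact map_eq_of_map_le_map_iff wbar _ hτ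
  · exact (congrArg (σ.liftNormal Ω) (τ.commutes x)).trans (hcomm x)

end ValuedFieldExt

/-! ### Degrees of henselizations. -/

namespace ValuedFieldExt
open IntermediateField IsLocalRing IsDedekindDomain

section Degree
variable {K L Ω Θ : Type*} [Field K] [Field L] [Field Ω] [Algebra K L] [Algebra K Ω]
  [Algebra L Ω] [IsScalarTower K L Ω] [Normal K Ω] [LinearOrderedCommGroupWithZero Θ]

theorem henselization_le_restrictScalars (wbar : Valuation Ω Θ) :
    henselization K wbar ≤ (henselization L wbar).restrictScalars K :=
  fun _ hx => henselization_le_henselization (K := K) (L := L) wbar hx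

theorem henselDegree_eq_finrank_extendScalars (wbar : Valuation Ω Θ) :
    henselDegree K L wbar = Module.finrank (henselization K wbar)
      (extendScalars (henselization_le_restrictScalars (K := K) (L := L) wbar)) :=
  IntermediateField.relfinrank_eq_finrank_of_le (henselization_le_restrictScalars wbar)

/-- `K^h|K` is separable, hence linearly disjoint from the purely inseparable `L|K`, and `L^h` is
their compositum. -/
theorem henselDegree_eq_finrank_of_isPurelyInseparable [FiniteDimensional K L]
    [IsPurelyInseparable K L] (wbar : Valuation Ω Θ) :
    henselDegree K L wbar = Module.finrank K L := by
  have hdis := linearDisjoint_of_isPurelyInseparable_of_isSeparable (E := L) (henselization K wbar)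
  have h := congrArg Cardinal.toNat (hdis.lift_adjoin_rank_eq_lift_rank_right_of_isAlgebraic_left)
  rw [Cardinal.toNat_lift, Cardinal.toNat_lift] at h
  have key : ∀ E : IntermediateField L Ω, E = adjoin L (henselization K wbar : Set Ω) →
      ∀ hle : henselization K wbar ≤ E.restrictScalars K,
        Module.finrank (henselization K wbar) (extendScalars hle) = Module.finrank K L := by
    rintro _ rfl hle
    exact h
  rw [henselDegree_eq_finrank_extendScalars]
  exact key _ (henselization_eq_adjoin wbar) _

theorem restrictScalars_henselization_eq (wbar : Valuation Ω Θ) (α : L) (hα : K⟮α⟯ = ⊤) :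
    extendScalars (henselization_le_restrictScalars (K := K) (L := L) wbar) =
      (henselization K wbar)⟮algebraMap L Ω α⟯ := by
  refine le_antisymm ?_ ?_
  · intro x hx
    change x ∈ henselization L wbar at hx
    rw [henselization_eq_adjoin (K := K)] at hx
    have hL : ∀ y : L, algebraMap L Ω y ∈ (henselization K wbar)⟮algebraMap L Ω α⟯ := by
      intro y
      have hy : y ∈ K⟮α⟯ := hα ▸ mem_top
      have hle : (K⟮α⟯).map (IsScalarTower.toAlgHom K L Ω) ≤
          ((henselization K wbar)⟮algebraMap L Ω α⟯).restrictScalars K := by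
        rw [map_le_iff_le_comap, adjoin_simple_le_iff]
        exact mem_adjoin_simple_self (henselization K wbar) (algebraMap L Ω α)
      exact hle ⟨y, hy, rfl⟩
    induction hx using adjoin_induction with
    | mem x hx => exact IntermediateField.algebraMap_mem (henselization K wbar)⟮algebraMap L Ω α⟯ (⟨x, hx⟩ : henselization K wbar)
    | algebraMap y => exact hL y
    | add x y _ _ hx hy => exact add_mem hx hy
    | inv x _ hx => exact inv_mem hx
    | mul x y _ _ hx hy => exact mul_mem hx hy
  · rw [adjoin_simple_le_iff]
    exact IntermediateField.algebraMap_mem (henselization L wbar) α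

/-- For a primitive element `α`, `L^h = K^h(α)`. The fixed field of `D` in `L` embeds into `K^h`, so
the degree of `α` over `K^h` is at most `|D|`. Conversely, each `σ` in `D` lifts to an isometry of
`Ω`, which fixes `K^h`, so the `|D|` distinct elements `σ α` are conjugate over `K^h`. -/
theorem henselDegree_eq_card [FiniteDimensional K L] [IsGalois K L] (wbar : Valuation Ω Θ)
    (hlift : ∀ σ ∈ isometryGroup K (wbar.comap (algebraMap L Ω)),
      ∃ τ : Ω ≃ₐ[K] Ω, (∀ x, wbar (τ x) = wbar x) ∧
        ∀ x, τ (algebraMap L Ω x) = algebraMap L Ω (σ x)) :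
    henselDegree K L wbar = Nat.card (isometryGroup K (wbar.comap (algebraMap L Ω))) := by
  have : Algebra.IsAlgebraic K Ω := Normal.toIsAlgebraic
  set D := isometryGroup K (wbar.comap (algebraMap L Ω))
  let pb := Field.powerBasisOfFiniteOfSeparable K L
  set α := pb.gen
  have hα : K⟮α⟯ = ⊤ := by
    exact adjoin_eq_top_of_algebra K {α} pb.adjoin_gen_eq_top
  have hint : IsIntegral (henselization K wbar) (algebraMap L Ω α) :=
    (Algebra.IsIntegral.isIntegral (R := K) (algebraMap L Ω α)).tower_top
  have h1 : henselDegree K L wbar = (minpoly (henselization K wbar) (algebraMap L Ω α)).natDegree := by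
    rw [henselDegree_eq_finrank_extendScalars,
      restrictScalars_henselization_eq wbar α hα, adjoin.finrank hint]
  rw [h1]
  refine le_antisymm ?_ ?_
  · have hF : Module.finrank (fixedField D) L = Nat.card D := finrank_fixedField_eq_card D
    rw [← hF]
    refine le_trans ?_ (minpoly.natDegree_le (A := fixedField D) α)
    have hmem : ∀ x : fixedField D, algebraMap L Ω x ∈ henselization K wbar := by
      intro x
      rw [mem_henselization_iff]
      refine ⟨(Algebra.IsSeparable.isSeparable K (x : L)).map (IsScalarTower.toAlgHom K L Ω)
        (algebraMap L Ω).injective, fun τ hτ => ?_⟩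
      have hc := τ.restrictNormal_commutes L
      rw [← hc]
      congr 1
      refine (mem_fixedField_iff _ _).1 x.2 (τ.restrictNormal L) fun y => ?_
      change wbar (algebraMap L Ω (τ.restrictNormal L y)) = wbar (algebraMap L Ω y)
      rw [hc, hτ]
    let φ : fixedField D →+* henselization K wbar :=
      ((algebraMap L Ω).comp (algebraMap (fixedField D) L)).codRestrict (henselization K wbar) hmem
    have hmonic : (minpoly (fixedField D) α).Monic := minpoly.monic (Algebra.IsIntegral.isIntegral _)
    rw [← Polynomial.natDegree_map φ]
    refine Polynomial.natDegree_le_natDegree (minpoly.min _ _ (hmonic.map φ) ?_)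
    rw [Polynomial.aeval_def, Polynomial.eval₂_map]
    change Polynomial.eval₂ ((algebraMap L Ω).comp (algebraMap (fixedField D) L)) (algebraMap L Ω α) _ = 0
    rw [← Polynomial.hom_eval₂]
    exact (congrArg _ (minpoly.aeval (fixedField D) α)).trans (map_zero _)
  · have hroot : ∀ σ : D, algebraMap L Ω ((σ : L ≃ₐ[K] L) α) ∈
        (minpoly (henselization K wbar) (algebraMap L Ω α)).rootSet Ω := by
      rintro ⟨σ, hσ⟩
      obtain ⟨τ, hτ, hτσ⟩ := hlift σ hσ
      let τ' : Ω ≃ₐ[henselization K wbar] Ω :=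
        { τ with commutes' := fun x => ((mem_henselization_iff wbar _).1 x.2).2 τ hτ }
      refine Polynomial.mem_rootSet.2 ⟨minpoly.ne_zero hint, ?_⟩
      rw [← hτσ]
      change Polynomial.aeval (τ' (algebraMap L Ω α)) _ = 0
      rw [Polynomial.aeval_algHom_apply, minpoly.aeval, map_zero]
    let f : D → (minpoly (henselization K wbar) (algebraMap L Ω α)).rootSet Ω :=
      fun σ => ⟨_, hroot σ⟩
    have hf : Function.Injective f := by
      intro σ σ' h
      have h' : (σ : L ≃ₐ[K] L) α = (σ' : L ≃ₐ[K] L) α :=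
        (algebraMap L Ω).injective (congrArg Subtype.val h)
      have := pb.algHom_ext (f := ((σ : L ≃ₐ[K] L) : L →ₐ[K] L))
        (g := ((σ' : L ≃ₐ[K] L) : L →ₐ[K] L)) h'
      exact Subtype.ext (AlgEquiv.ext fun x => DFunLike.congr_fun this x)
    calc Nat.card D ≤ Nat.card ((minpoly (henselization K wbar) (algebraMap L Ω α)).rootSet Ω) :=
          Nat.card_le_card_of_injective f hf
      _ ≤ _ := by
          rw [Nat.card_coe_set_eq]
          exact Polynomial.ncard_rootSet_le _ _

end Degree
end ValuedFieldExt

/-! ### Defectlessness from finiteness of integral closures. -/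

namespace ValuedFieldExt
open IntermediateField IsLocalRing IsDedekindDomain

/-- Lets the integral closure of `A` in `M` take over the role of `A` for the upper step `N|M` of a
tower. -/
theorem finite_integralClosure_integralClosure (A M N : Type*) [CommRing A] [Field M] [Field N]
    [Algebra A M] [Algebra A N] [Algebra M N] [IsScalarTower A M N]
    [Module.Finite A (integralClosure A N)] :
    Module.Finite (integralClosure A M) (integralClosure (integralClosure A M) N) := by
  let f : integralClosure A N →ₗ[A] integralClosure (integralClosure A M) N :=
    { toFun := fun x => ⟨x, x.2.tower_top⟩
      map_add' := fun _ _ => rfl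
      map_smul' := fun _ _ => rfl }
  have hf : Function.Surjective f := fun x => ⟨⟨x, isIntegral_trans (R := A) _ x.2⟩, rfl⟩
  have := Module.Finite.of_surjective f hf
  exact Module.Finite.of_restrictScalars_finite A _ _

theorem IsCentered.integralClosure {A M Ω Θ : Type*} [CommRing A] [Field M] [Field Ω]
    [Algebra A M] [Algebra A Ω] [Algebra M Ω] [IsScalarTower A M Ω]
    [LinearOrderedCommGroupWithZero Θ] {wbar : Valuation Ω Θ} (hc : IsCentered A wbar) :
    IsCentered (integralClosure A M) wbar := by
  refine ⟨fun a => valuation_le_one_of_isIntegral wbar hc.le_one ?_, ?_⟩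
  · exact a.2.map (IsScalarTower.toAlgHom A M Ω)
  · obtain ⟨a, ha, hlt⟩ := hc.exists_lt_one
    have : algebraMap (_root_.integralClosure A M) Ω (algebraMap A _ a) = algebraMap A Ω a :=
      (IsScalarTower.algebraMap_apply A M Ω a).symm
    exact ⟨algebraMap A _ a, by rwa [this], by rwa [this]⟩

section Normal
variable {A K L N Ω Θ : Type*} [CommRing A] [IsDedekindDomain A] [Field K] [Algebra A K]
  [IsFractionRing A K] [Field Ω] [Algebra K Ω] [Algebra A Ω] [IsScalarTower A K Ω] [Normal K Ω]
  [LinearOrderedCommGroupWithZero Θ] [Field N] [Algebra K N] [Algebra A N] [IsScalarTower A K N]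
  [Algebra N Ω] [IsScalarTower K N Ω] [IsScalarTower A N Ω] [FiniteDimensional K N]

theorem henselDegree_eq_ramInertia_of_isGalois [IsGalois K N] (wbar : Valuation Ω Θ)
    (hc : IsCentered A wbar) :
    henselDegree K N wbar = ramInertia K N wbar ∧ ramInertia K N wbar ≠ 0 := by
  have : Module.Finite A (integralClosure A N) := IsIntegralClosure.finite A K N _
  have := isDedekindDomain_integralClosure (A := A) (L := N) K
  have := integralClosure.isFractionRing_of_finite_extension (A := A) K N
  rw [ramInertia_eq_card wbar hc]
  exact ⟨henselDegree_eq_card wbar fun σ hσ =>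
    exists_isometry_lift (B := integralClosure A N) wbar hc.integralClosure σ hσ, Nat.card_pos.ne'⟩

theorem henselDegree_eq_ramInertia_of_isPurelyInseparable [IsPurelyInseparable K N]
    [Module.Finite A (integralClosure A N)] (wbar : Valuation Ω Θ) (hc : IsCentered A wbar) :
    henselDegree K N wbar = ramInertia K N wbar ∧ ramInertia K N wbar ≠ 0 := by
  rw [ramInertia_eq_finrank wbar hc]
  exact ⟨henselDegree_eq_finrank_of_isPurelyInseparable wbar, Module.finrank_pos.ne'⟩

theorem henselDegree_eq_ramInertia_of_normal [Normal K N]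
    [Module.Finite A (integralClosure A N)] (wbar : Valuation Ω Θ) (hc : IsCentered A wbar) :
    henselDegree K N wbar = ramInertia K N wbar ∧ ramInertia K N wbar ≠ 0 := by
  set M := separableClosure K N
  have : IsScalarTower A M N := .of_algebraMap_eq fun a => by
    rw [IsScalarTower.algebraMap_apply A K M, ← IsScalarTower.algebraMap_apply K M N,
      ← IsScalarTower.algebraMap_apply A K N]
  have : IsScalarTower A M Ω := .of_algebraMap_eq fun a => by
    rw [IsScalarTower.algebraMap_apply M N Ω, ← IsScalarTower.algebraMap_apply A M N,
      ← IsScalarTower.algebraMap_apply A N Ω]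
  have : Normal M Ω := Normal.tower_top_of_normal K M Ω
  have : Module.Finite A (integralClosure A M) := IsIntegralClosure.finite A K M _
  have := isDedekindDomain_integralClosure (A := A) (L := M) K
  have := integralClosure.isFractionRing_of_finite_extension (A := A) K M
  have := finite_integralClosure_integralClosure A M N
  have h1 := henselDegree_eq_ramInertia_of_isGalois (A := A) (K := K) (N := M) wbar hc
  have h2 := henselDegree_eq_ramInertia_of_isPurelyInseparable (A := integralClosure A M)
    (K := M) (N := N) wbar hc.integralClosure
  rw [← henselDegree_mul (K := K) (L := M) (M := N), ← ramInertia_mul (K := K) (L := M) (M := N),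
    h1.1, h2.1]
  exact ⟨rfl, mul_ne_zero h1.2 h2.2⟩

end Normal

/-- A discrete valuation is defectless if the integral closures of a Dedekind domain on which it is
centered are finite. -/
theorem henselDegree_eq_ramInertia {A K L Ω : Type u} {Θ : Type*} [CommRing A] [IsDedekindDomain A]
    [Field K] [Algebra A K] [IsFractionRing A K] [Field Ω] [Algebra K Ω] [Algebra A Ω]
    [IsScalarTower A K Ω] [Normal K Ω] [LinearOrderedCommGroupWithZero Θ] [Field L] [Algebra K L]
    [Algebra A L] [IsScalarTower A K L] [Algebra L Ω] [IsScalarTower K L Ω] [IsScalarTower A L Ω]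
    [FiniteDimensional K L]
    (hfin : ∀ (E : Type u) [Field E] [Algebra K E] [Algebra A E] [IsScalarTower A K E]
      [FiniteDimensional K E], Module.Finite A (integralClosure A E))
    (wbar : Valuation Ω Θ) (hc : IsCentered A wbar) :
    henselDegree K L wbar = ramInertia K L wbar ∧ ramInertia K L wbar ≠ 0 := by
  -- Both `N|K` and `N|L` are normal. Multiplicativity then gives the claim for `L|K` by cancelling
  -- the nonzero factor of `N|L`.
  let N := normalClosure K L Ω
  have : IsScalarTower A N Ω := .of_algebraMap_eq fun a => by
    rw [IsScalarTower.algebraMap_apply A K N, ← IsScalarTower.algebraMap_apply K N Ω,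
      ← IsScalarTower.algebraMap_apply A K Ω]
  have : IsScalarTower A L N := .of_algebraMap_eq fun a => by
    rw [IsScalarTower.algebraMap_apply A K L, ← IsScalarTower.algebraMap_apply K L N,
      ← IsScalarTower.algebraMap_apply A K N]
  have := hfin N
  have := hfin L
  have := isDedekindDomain_integralClosure (A := A) (L := L) K
  have := integralClosure.isFractionRing_of_finite_extension (A := A) K L
  have := finite_integralClosure_integralClosure A L N
  have : Normal L Ω := Normal.tower_top_of_normal K L Ω
  have : Normal L N := Normal.tower_top_of_normal K L N
  have : FiniteDimensional L N := FiniteDimensional.right K L N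
  have h1 := henselDegree_eq_ramInertia_of_normal (A := A) (K := K) (N := N) wbar hc
  have h2 := henselDegree_eq_ramInertia_of_normal (A := integralClosure A L) (K := L) (N := N)
    wbar hc.integralClosure
  rw [← henselDegree_mul (K := K) (L := L) (M := N), ← ramInertia_mul (K := K) (L := L) (M := N),
    h2.1] at h1
  exact ⟨mul_right_cancel₀ h2.2 h1.1, left_ne_zero_of_mul h1.2⟩

end ValuedFieldExt

/-! ### Finiteness of the integral closure of `k[X]`. -/

namespace ValuedFieldExt
open IntermediateField Polynomial

/-- Over a field of exponential characteristic `p`, finitely many polynomials have `p ^ n`-th roots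
in a finite, integrally closed extension of the polynomial ring. -/
theorem exists_finite_isIntegrallyClosed_pow_eq (k Ω : Type*) [Field k] [Field Ω] [IsAlgClosed Ω]
    [Algebra k Ω] [Algebra k[X] Ω] [IsScalarTower k k[X] Ω] [FaithfulSMul k[X] Ω]
    (p n : ℕ) [ExpChar Ω p] (Z : Finset k[X]) :
    ∃ D : Subalgebra k[X] Ω, Module.Finite k[X] D ∧ IsIntegrallyClosed D ∧
      ∀ a ∈ Z, ∃ d ∈ D, d ^ p ^ n = algebraMap k[X] Ω a := by
  classical
  have hq : 0 < p ^ n := expChar_pow_pos Ω p n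
  choose r hr using fun z : Ω => IsAlgClosed.exists_pow_nat_eq z hq
  -- With `q = p ^ n`, `s` is a `q`-th root of the variable and `T` consists of `q`-th roots of the
  -- coefficients in question. The ring `D` generated by them is `k'[s]`, a polynomial ring since
  -- `s` is transcendental over `k' = k(T)`.
  set s : Ω := r (algebraMap k[X] Ω X) with hs
  let T : Set Ω := (fun z : k => r (algebraMap k Ω z)) '' (Z.biUnion fun a => a.coeffs)
  have hTfin : T.Finite := (Finset.finite_toSet _).image _
  have hTint : ∀ x ∈ T, IsIntegral k x := by
    rintro _ ⟨z, -, rfl⟩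
    exact IsIntegral.of_pow hq (by rw [hr]; exact isIntegral_algebraMap)
  have : Finite T := hTfin
  let k' := adjoin k T
  have : FiniteDimensional k k' := finiteDimensional_adjoin hTint
  have htr : Transcendental k' s := by
    refine Transcendental.extendScalars (R := k) k' fun h => ?_
    have h1 : IsAlgebraic k (algebraMap k[X] Ω X) := by rw [← hr (algebraMap k[X] Ω X)]; exact h.pow _
    exact (transcendental_X k) ((isAlgebraic_algebraMap_iff
      (FaithfulSMul.algebraMap_injective k[X] Ω)).1 h1)
  have haeval (a : k[X]) : algebraMap k[X] Ω a = aeval (algebraMap k[X] Ω X) a := by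
    rw [aeval_algebraMap_apply, aeval_X_left_apply]
  let D : Subalgebra k[X] Ω := Algebra.adjoin k[X] (insert s T)
  have hsD : s ∈ D := Algebra.subset_adjoin (Set.mem_insert _ _)
  have hTD : ∀ x ∈ T, x ∈ D := fun x hx => Algebra.subset_adjoin (Set.mem_insert_of_mem _ hx)
  have hk'D (x : k') : (x : Ω) ∈ D := by
    have hx : (x : Ω) ∈ k'.toSubalgebra := x.2
    rw [adjoin_toSubalgebra_of_isAlgebraic fun y hy => (hTint y hy).isAlgebraic] at hx
    have hle : Algebra.adjoin k T ≤ D.restrictScalars k := Algebra.adjoin_le hTD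
    exact hle hx
  have hmem (x : Ω) : x ∈ D ↔ x ∈ Algebra.adjoin k' {s} := by
    constructor
    · intro hx
      have hsA : s ∈ Algebra.adjoin k' {s} := Algebra.self_mem_adjoin_singleton _ _
      induction hx using Algebra.adjoin_induction with
      | mem x hx =>
        obtain rfl | hx := hx
        · exact hsA
        · exact (Algebra.adjoin k' {s}).algebraMap_mem (⟨x, subset_adjoin k T hx⟩ : k')
      | algebraMap a =>
        rw [haeval, ← hr (algebraMap k[X] Ω X), ← aeval_map_algebraMap k' (r _ ^ p ^ n)]
        rw [aeval_eq_sum_range]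
        exact Subalgebra.sum_mem _ fun i _ => Subalgebra.smul_mem _
          (Subalgebra.pow_mem _ (Subalgebra.pow_mem _ hsA _) _) _
      | add x y _ _ hx hy => exact add_mem hx hy
      | mul x y _ _ hx hy => exact mul_mem hx hy
    · intro hx
      induction hx using Algebra.adjoin_induction with
      | mem x hx => rw [Set.mem_singleton_iff.1 hx]; exact hsD
      | algebraMap a => exact hk'D a
      | add x y _ _ hx hy => exact add_mem hx hy
      | mul x y _ _ hx hy => exact mul_mem hx hy
  -- Since the `q`-th power map is additive, a root of `∑ aᵢ Xⁱ` is obtained by taking roots of the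
  -- `aᵢ` and of `X` separately.
  refine ⟨D, ?_, ?_, fun a ha => ⟨∑ i ∈ Finset.range (a.natDegree + 1),
    r (algebraMap k Ω (a.coeff i)) * s ^ i, ?_, ?_⟩⟩
  · refine Module.Finite.iff_fg.2 (fg_adjoin_of_finite (hTfin.insert s) ?_)
    rintro x (rfl | hx)
    · exact IsIntegral.of_pow hq (by rw [hr]; exact isIntegral_algebraMap)
    · exact (hTint x hx).tower_top
  · let e : k'[X] ≃+* D := (Polynomial.algEquivOfTranscendental k' s htr).toRingEquiv.trans
      { toFun := fun x => ⟨x, (hmem _).2 x.2⟩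
        invFun := fun x => ⟨x, (hmem _).1 x.2⟩
        left_inv := fun _ => rfl
        right_inv := fun _ => rfl
        map_mul' := fun _ _ => rfl
        map_add' := fun _ _ => rfl }
    exact IsIntegrallyClosed.of_equiv e
  · refine Subalgebra.sum_mem _ fun i _ => Subalgebra.mul_mem _ ?_ (Subalgebra.pow_mem _ hsD _)
    by_cases hi : a.coeff i = 0
    · have : r (algebraMap k Ω (a.coeff i)) = 0 :=
        pow_eq_zero_iff hq.ne' |>.1 (by rw [hr, hi, map_zero])
      rw [this]; exact zero_mem _
    · exact hTD _ ⟨_, Finset.mem_coe.2 (Finset.mem_biUnion.2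
        ⟨a, ha, coeff_mem_coeffs hi⟩), rfl⟩
  · rw [← iterateFrobenius_def, map_sum, haeval, aeval_eq_sum_range]
    refine Finset.sum_congr rfl fun i _ => ?_
    rw [iterateFrobenius_def, mul_pow, hr, ← pow_mul, mul_comm i, pow_mul, hr, Algebra.smul_def]

/-- Let `D` be a finite integrally closed extension of a noetherian domain `A` with field of
fractions `F`. The integral closure of `A` in a field that embeds into a finite separable extension
of `F` is finite. -/
theorem finite_integralClosure_of_algHom {A D E E' : Type*} (F : Type*) [CommRing A]
    [IsNoetherianRing A] [CommRing D] [IsDomain D] [IsIntegrallyClosed D] [Algebra A D]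
    [Module.Finite A D] [Field F] [Algebra D F] [IsFractionRing D F] [Field E'] [Algebra F E']
    [FiniteDimensional F E'] [Algebra.IsSeparable F E'] [Algebra D E'] [IsScalarTower D F E']
    [Algebra A E'] [IsScalarTower A D E'] [Field E] [Algebra A E] (f : E →ₐ[A] E') :
    Module.Finite A (integralClosure A E) := by
  have : IsNoetherianRing D := IsNoetherianRing.of_finite A D
  have : Module.Finite D (integralClosure D E') := IsIntegralClosure.finite D F E' _
  have : Module.Finite A (integralClosure D E') := Module.Finite.trans D _
  have : IsNoetherian A (integralClosure D E') := isNoetherian_of_isNoetherianRing_of_finite A _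
  let g : integralClosure A E →ₗ[A] integralClosure D E' :=
    { toFun := fun x => ⟨f x, (x.2.map f).tower_top⟩
      map_add' := fun x y => Subtype.ext (map_add f (x : E) y)
      map_smul' := fun a x => Subtype.ext (map_smul f a (x : E)) }
  exact Module.Finite.of_injective g fun x y h =>
    Subtype.ext (f.injective (congrArg Subtype.val h))

/-- The minimal polynomial over `P` descends to a separable polynomial over `F` vanishing at `z`.
Used to pass from the perfect closure to the much smaller field `Frac D`. -/
theorem isSeparable_of_coeff_mem_range {P F Ω : Type*} [Field P] [Field F] [Field Ω] [Algebra P Ω]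
    [Algebra F Ω] {z : Ω} (hz : IsSeparable P z)
    (h : ∀ i, algebraMap P Ω ((minpoly P z).coeff i) ∈ (algebraMap F Ω).range) :
    IsSeparable F z := by
  have hlift : (minpoly P z).map (algebraMap P Ω) ∈ Polynomial.lifts (algebraMap F Ω) := by
    rw [Polynomial.lifts_iff_coeff_lifts]
    intro j
    rw [coeff_map]
    exact h j
  obtain ⟨g, hg⟩ := (Polynomial.mem_lifts _).1 hlift
  refine ((Polynomial.separable_map (algebraMap F Ω)).1 ?_).of_dvd (minpoly.dvd F z (p := g) ?_)
  · rw [hg]; exact Polynomial.Separable.map hz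
  · rw [aeval_def, ← eval_map, hg, eval_map_algebraMap, minpoly.aeval]

/-- Let `D` be a finite integrally closed extension of a noetherian domain `A`, and let `E` be a
finite extension of `Frac A` that is separable over `Frac D` inside a common extension. Then the
integral closure of `A` in `E` is finite. -/
theorem finite_integralClosure_of_isSeparable {A K E ι : Type*} {D Ω : Type u} [CommRing A]
    [IsNoetherianRing A] [Field K] [Algebra A K] [IsFractionRing A K]
    [CommRing D] [IsDomain D] [IsIntegrallyClosed D] [Algebra A D] [Module.Finite A D]
    [Field Ω] [Algebra A Ω] [Algebra D Ω] [IsScalarTower A D Ω] [FaithfulSMul D Ω]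
    [Algebra K Ω] [IsScalarTower A K Ω] [Field E] [Algebra A E] [Algebra K E] [Algebra E Ω]
    [IsScalarTower K E Ω] [IsScalarTower A E Ω] [Finite ι] (b : Module.Basis ι K E)
    (hsep : ∀ (F : Type u) [Field F] [Algebra D F] [IsFractionRing D F] [Algebra F Ω]
      [IsScalarTower D F Ω] (i : ι), IsSeparable F (algebraMap E Ω (b i))) :
    Module.Finite A (integralClosure A E) := by
  cases nonempty_fintype ι
  let F := FractionRing D
  let : Algebra F Ω := FractionRing.liftAlgebra D Ω
  have : IsScalarTower D F Ω := FractionRing.isScalarTower_liftAlgebra D Ω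
  have hKF (r : K) : ∃ z : F, algebraMap F Ω z = algebraMap K Ω r := by
    obtain ⟨a, c, -, rfl⟩ := IsFractionRing.div_surjective (A := A) r
    refine ⟨algebraMap D F (algebraMap A D a) / algebraMap D F (algebraMap A D c), ?_⟩
    simp only [map_div₀, ← IsScalarTower.algebraMap_apply]
  let S : Set Ω := Set.range fun i => algebraMap E Ω (b i)
  have hS : ∀ z ∈ S, IsSeparable F z := by
    rintro _ ⟨i, rfl⟩
    exact hsep F i
  let E' := adjoin F S
  have : Finite S := Set.finite_range _
  have : Algebra.IsSeparable F E' := (isSeparable_adjoin_iff_isSeparable F Ω).2 hS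
  have : FiniteDimensional F E' := finiteDimensional_adjoin fun z hz => (hS z hz).isIntegral
  have hE' (z : E) : algebraMap E Ω z ∈ E' := by
    rw [← b.sum_repr z, map_sum]
    refine sum_mem fun i _ => ?_
    obtain ⟨w, hw⟩ := hKF (b.repr z i)
    rw [Algebra.smul_def, map_mul, ← IsScalarTower.algebraMap_apply, ← hw]
    exact mul_mem (E'.algebraMap_mem w) (subset_adjoin F S ⟨i, rfl⟩)
  let f : E →+* E' := (algebraMap E Ω).codRestrict E' hE'
  let : Algebra D E' := ((algebraMap F E').comp (algebraMap D F)).toAlgebra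
  let : Algebra A E' := ((algebraMap D E').comp (algebraMap A D)).toAlgebra
  have : IsScalarTower D F E' := .of_algebraMap_eq fun _ => rfl
  have : IsScalarTower A D E' := .of_algebraMap_eq fun _ => rfl
  refine finite_integralClosure_of_algHom (D := D) (E' := E') F { f with commutes' := fun a => ?_ }
  refine Subtype.ext ((IsScalarTower.algebraMap_apply A E Ω a).symm.trans ?_)
  rw [IsScalarTower.algebraMap_apply A D Ω]
  exact IsScalarTower.algebraMap_apply D F Ω (algebraMap A D a)

/-- The integral closure of a polynomial ring over a field in a finite extension of its field of
fractions is finite. -/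
theorem finite_integralClosure_polynomial (k E : Type*) [Field k] [Field E]
    [Algebra (RatFunc k) E] [Algebra k[X] E] [IsScalarTower k[X] (RatFunc k) E]
    [FiniteDimensional (RatFunc k) E] : Module.Finite k[X] (integralClosure k[X] E) := by
  classical
  let Ω := AlgebraicClosure E
  -- Over the perfect closure everything is separable, and only the finitely many coefficients
  -- collected in `C` matter for a basis of `E`.
  let P := perfectClosure (RatFunc k) Ω
  let : Algebra k Ω := ((algebraMap k[X] Ω).comp (algebraMap k k[X])).toAlgebra
  have : IsScalarTower k k[X] Ω := .of_algebraMap_eq fun _ => rfl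
  have : IsScalarTower k[X] (RatFunc k) Ω := .of_algebraMap_eq fun a => by
    rw [IsScalarTower.algebraMap_apply k[X] E Ω, IsScalarTower.algebraMap_apply (RatFunc k) E Ω,
      ← IsScalarTower.algebraMap_apply k[X] (RatFunc k) E]
  have hinj : Function.Injective (algebraMap k[X] Ω) := by
    rw [IsScalarTower.algebraMap_eq k[X] (RatFunc k) Ω]
    exact (algebraMap (RatFunc k) Ω).injective.comp (IsFractionRing.injective k[X] (RatFunc k))
  have : FaithfulSMul k[X] Ω := (faithfulSMul_iff_algebraMap_injective _ _).2 hinj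
  have : Algebra.IsAlgebraic (RatFunc k) Ω := Algebra.IsAlgebraic.trans (RatFunc k) E Ω
  obtain ⟨p, hp⟩ := ExpChar.exists (RatFunc k)
  have : ExpChar Ω p := expChar_of_injective_algebraMap (algebraMap (RatFunc k) Ω).injective p
  let b := Module.finBasis (RatFunc k) E
    -- the coefficients of the minimal polynomials over the perfect closure
  let C : Finset P := Finset.univ.biUnion fun i => (minpoly P (algebraMap E Ω (b i))).coeffs
  have hC (c : P) : ∃ n : ℕ, ∃ x : RatFunc k, algebraMap (RatFunc k) Ω x = (c : Ω) ^ p ^ n :=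
    (mem_perfectClosure_iff_pow_mem p).1 c.2
  choose m hm using hC
  let n := C.sup m
  have hC (c : P) : ∃ x y : k[X], y ≠ 0 ∧ (c ∈ C →
      (algebraMap k[X] Ω y * c) ^ p ^ n = algebraMap k[X] Ω x) := by
    obtain ⟨x, hx⟩ := hm c
    -- If `c ^ p ^ m = num / denom`, then `c ^ p ^ n` is the `p ^ (n - m)`-th power of that
    -- fraction; multiplying by `denom ^ p ^ n` clears the denominator.
    refine ⟨x.num ^ p ^ (n - m c) * x.denom ^ (p ^ n - p ^ (n - m c)), x.denom, x.denom_ne_zero,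
      fun hc => ?_⟩
    have hle : m c ≤ n := Finset.le_sup hc
    have hd : algebraMap k[X] Ω x.denom ≠ 0 := by
      rw [Ne, map_eq_zero_iff _ hinj]; exact x.denom_ne_zero
    have hx' : algebraMap k[X] Ω x.denom * (c : Ω) ^ p ^ m c = algebraMap k[X] Ω x.num := by
      rw [← hx]
      have : algebraMap (RatFunc k) Ω x = algebraMap k[X] Ω x.num / algebraMap k[X] Ω x.denom := by
        conv_lhs => rw [← RatFunc.num_div_denom x]
        rw [map_div₀, ← IsScalarTower.algebraMap_apply, ← IsScalarTower.algebraMap_apply]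
      rw [this, mul_div_cancel₀ _ hd]
    have hle' : p ^ (n - m c) ≤ p ^ n :=
      Nat.pow_le_pow_right (expChar_pos Ω p) (Nat.sub_le _ _)
    rw [map_mul, map_pow, map_pow, ← hx', mul_pow, mul_pow, mul_right_comm, ← pow_add, ← pow_mul,
      ← pow_add, Nat.add_sub_cancel' hle', Nat.add_sub_cancel' hle]
  choose x y hy hxy using hC
  obtain ⟨D, hDfin, hD, hroot⟩ :=
    exists_finite_isIntegrallyClosed_pow_eq k Ω p n (C.image x)
  have hCD (c : P) (hc : c ∈ C) : algebraMap k[X] Ω (y c) * c ∈ D := by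
    obtain ⟨d, hd, h⟩ := hroot (x c) (Finset.mem_image_of_mem x hc)
    rw [← hxy c hc] at h
    -- `p ^ n`-th roots are unique in `Ω`, so the root found in `D` is the required element.
    rwa [← iterateFrobenius_inj Ω p n h]
  refine finite_integralClosure_of_isSeparable (D := D) (Ω := Ω) b fun F _ _ _ _ _ i => ?_
  refine isSeparable_of_coeff_mem_range (Algebra.IsSeparable.isSeparable P _) fun j => ?_
  by_cases h0 : (minpoly P (algebraMap E Ω (b i))).coeff j = 0
  · rw [h0, map_zero]; exact zero_mem _
  set c := (minpoly P (algebraMap E Ω (b i))).coeff j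
  have hc : c ∈ C := Finset.mem_biUnion.2 ⟨i, Finset.mem_univ i, coeff_mem_coeffs h0⟩
  refine ⟨algebraMap D F ⟨_, hCD c hc⟩ / algebraMap D F (algebraMap k[X] D (y c)), ?_⟩
  rw [map_div₀, ← IsScalarTower.algebraMap_apply, ← IsScalarTower.algebraMap_apply]
  refine mul_div_cancel_left₀ _ ?_
  rw [← IsScalarTower.algebraMap_apply, Ne, map_eq_zero_iff _ hinj]; exact hy c

end ValuedFieldExt

/-! ### The `t`-adic valuation is defectless. -/

namespace ValuedFieldExt
open IntermediateField Polynomial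

theorem isDefectless_idealX (k : Type u) [Field k] :
    IsDefectless ((Polynomial.idealX k).valuation (RatFunc k)) := by
  intro L _ _ _ Δ _ w _ Θ _ wbar _
  let Ω := AlgebraicClosure L
  let v := (Polynomial.idealX k).valuation (RatFunc k)
  let : Algebra k[X] L := ((algebraMap (RatFunc k) L).comp (algebraMap k[X] (RatFunc k))).toAlgebra
  have : IsScalarTower k[X] (RatFunc k) L := .of_algebraMap_eq fun _ => rfl
  have : IsScalarTower k[X] (RatFunc k) Ω := .of_algebraMap_eq fun a => by
    rw [IsScalarTower.algebraMap_apply k[X] L Ω, IsScalarTower.algebraMap_apply (RatFunc k) L Ω,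
      ← IsScalarTower.algebraMap_apply k[X] (RatFunc k) L]
  have : Algebra.IsAlgebraic (RatFunc k) Ω := Algebra.IsAlgebraic.trans (RatFunc k) L Ω
  have : Normal (RatFunc k) Ω := normal_iff.2 fun x =>
    ⟨(Algebra.IsAlgebraic.isAlgebraic x).isIntegral, IsAlgClosed.splits _⟩
  have : v.HasExtension wbar := hasExtension_trans v w wbar
  have hc : IsCentered k[X] wbar := by
    refine ⟨fun a => ?_, X, ?_, ?_⟩
    · rw [IsScalarTower.algebraMap_apply k[X] (RatFunc k) Ω,
        Valuation.HasExtension.val_map_le_one_iff v]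
      exact (Polynomial.idealX k).valuation_le_one a
    · rw [IsScalarTower.algebraMap_apply k[X] (RatFunc k) Ω, RatFunc.algebraMap_X, _root_.map_ne_zero]
      exact RatFunc.X_ne_zero
    · rw [IsScalarTower.algebraMap_apply k[X] (RatFunc k) Ω,
        Valuation.HasExtension.val_map_lt_one_iff v, RatFunc.algebraMap_X,
        Polynomial.valuation_X_eq_neg_one]
      decide
  obtain ⟨h, h0⟩ := henselDegree_eq_ramInertia (A := k[X]) (K := RatFunc k) (L := L)
    (fun E _ _ _ _ _ => finite_integralClosure_polynomial k E) wbar hc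
  rw [defect_eq, h, div_self (Nat.cast_ne_zero.2 h0)]

end ValuedFieldExt

/-! ### A proper algebraic immediate extension of `k(t)`. -/

namespace ValuedFieldExt
open IntermediateField Polynomial IsLocalRing

/-- An extension in which the base field is dense is immediate. -/
theorem isImmediate_of_exists_sub_lt {K L Γ Δ : Type*} [Field K] [Field L] [Algebra K L]
    [LinearOrderedCommGroupWithZero Γ] [LinearOrderedCommGroupWithZero Δ] (v : Valuation K Γ)
    (w : Valuation L Δ) [v.HasExtension w]
    (h : ∀ x ≠ 0, ∃ y : K, w (x - algebraMap K L y) < w x) : IsImmediate v w := by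
  refine ⟨Subgroup.ext fun g => ?_, RingHom.injective
    (algebraMap (ResidueField v.valuationSubring) (ResidueField w.valuationSubring)), fun x => ?_⟩
  · rw [baseValGroup, mem_valGroup_iff, mem_valGroup_iff]
    constructor
    · rintro ⟨x, hx⟩
      have hx0 : x ≠ 0 := by rintro rfl; exact g.ne_zero (by rw [← hx, map_zero])
      obtain ⟨y, hy⟩ := h x hx0
      exact ⟨y, hx ▸ Valuation.map_eq_of_sub_lt w (by rwa [Valuation.map_sub_swap])⟩
    · rintro ⟨x, hx⟩
      exact ⟨_, hx⟩
  · obtain ⟨⟨x, hx⟩, rfl⟩ := residue_surjective x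
    by_cases hx0 : x = 0
    · subst hx0
      exact ⟨0, by rw [map_zero]; exact (map_zero _).symm⟩
    obtain ⟨y, hy⟩ := h x hx0
    have hxy : w (algebraMap K L y) = w x :=
      Valuation.map_eq_of_sub_lt w (by rwa [Valuation.map_sub_swap])
    have hyv : y ∈ v.valuationSubring := by
      rw [Valuation.mem_valuationSubring_iff, ← Valuation.HasExtension.val_map_le_one_iff v w, hxy]
      exact hx
    refine ⟨residue _ ⟨y, hyv⟩, ?_⟩
    rw [Valuation.HasExtension.algebraMap_residue_eq_residue_algebraMap, residue_eq_iff]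
    change w (algebraMap K L y - x) < 1
    rw [Valuation.map_sub_swap]
    exact hy.trans_le hx

open scoped RatFunc in
-- The Catalan series satisfies `c = 1 + X c²`, so `X c` is a root of `Y² - Y + X`. Its coefficients
-- are natural numbers, hence it exists in every characteristic.
theorem exists_laurentSeries_sq_add_X_eq (k : Type*) [Field k] :
    ∃ f : LaurentSeries k, f ^ 2 - f + algebraMap (RatFunc k) _ RatFunc.X = 0 := by
  have h := congrArg (PowerSeries.map (Nat.castRingHom k))
    PowerSeries.catalanSeries_sq_mul_X_add_one
  rw [map_add, map_mul, map_pow, map_one, PowerSeries.map_X] at h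
  set c := PowerSeries.map (Nat.castRingHom k) PowerSeries.catalanSeries
  have h' : (PowerSeries.X * c) ^ 2 - PowerSeries.X * c + PowerSeries.X = 0 := by
    linear_combination PowerSeries.X * h
  refine ⟨HahnSeries.ofPowerSeries ℤ k (PowerSeries.X * c), ?_⟩
  have := congrArg (HahnSeries.ofPowerSeries ℤ k) h'
  rw [map_add, map_sub, map_pow, map_zero, PowerSeries.coe_X] at this
  rw [← this]
  congr 1
  exact RatFunc.coe_X

/-- A root would be integral over `k[X]`, hence a polynomial `p` with `p (p - 1) = -X`; the left
side has even degree. -/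
theorem ratFunc_sq_sub_add_X_ne_zero {k : Type*} [Field k] (r : RatFunc k) :
    r ^ 2 - r + RatFunc.X ≠ 0 := by
  intro h
  have hint : IsIntegral k[X] r := by
    refine ⟨X ^ 2 - X + C X, by monicity!, ?_⟩
    simpa [RatFunc.algebraMap_X] using h
  obtain ⟨p, rfl⟩ := IsIntegrallyClosed.isIntegral_iff.1 hint
  rw [← RatFunc.algebraMap_X, ← map_pow, ← map_sub, ← map_add,
    map_eq_zero_iff _ (IsFractionRing.injective k[X] (RatFunc k))] at h
  have h' : p * (p - 1) = -X := by linear_combination h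
  have h0 : p * (p - 1) ≠ 0 := by rw [h']; exact neg_ne_zero.2 X_ne_zero
  have hd := congrArg natDegree h'
  rw [natDegree_mul (left_ne_zero_of_mul h0) (right_ne_zero_of_mul h0), natDegree_neg, natDegree_X,
    ← C_1, natDegree_sub_C] at hd
  omega

theorem not_isAlgebraicallyMaximal_idealX (k : Type u) [Field k] :
    ¬ IsAlgebraicallyMaximal ((Polynomial.idealX k).valuation (RatFunc k)) := by
  intro hmax
  obtain ⟨f, hf⟩ := exists_laurentSeries_sq_add_X_eq k
  let : Algebra (RatFunc k) (LaurentSeries k) := RatFunc.liftAlgebra k _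
  let v := (Polynomial.idealX k).valuation (RatFunc k)
  let L := adjoin (RatFunc k) {f}
  let w' : Valuation L _ := (Valued.v : Valuation (LaurentSeries k) _).comap (algebraMap L _)
  -- `w'` takes values in a type of the lowest universe, while the definition asks for universe `u`;
  -- the equivalent valuation attached to the valuation ring has its values there.
  let w := w'.valuationSubring.valuation
  have hw : w'.IsEquiv w := Valuation.isEquiv_valuation_valuationSubring w'
  have hw' (x : RatFunc k) : w' (algebraMap _ L x) = v x :=
    (RatFunc.valuation_eq_LaurentSeries_valuation k x).symm
  have : v.HasExtension w := by
    refine ⟨fun x y => ?_⟩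
    rw [← hw', ← hw']
    exact hw _ _
  have hint : IsIntegral (RatFunc k) f :=
    ⟨X ^ 2 - X + C RatFunc.X, by monicity!, by simpa using hf⟩
  have : Algebra.IsAlgebraic (RatFunc k) L := isAlgebraic_adjoin_simple hint
  have himm : IsImmediate v w := isImmediate_of_exists_sub_lt v w fun x hx => by
    -- Density of `k(X)` in `k((X))`, with `w' x` itself as the precision.
    obtain ⟨y, hy⟩ := LaurentSeries.exists_ratFunc_val_lt (K := k) (x : LaurentSeries k)
      (Units.mk0 (w' x) ((Valuation.ne_zero_iff _).2 hx))
    exact ⟨y, hw.lt_iff_lt.1 hy⟩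
  obtain ⟨r, hr⟩ := hmax L _ w himm (AdjoinSimple.gen _ f)
  have hr' : algebraMap (RatFunc k) (LaurentSeries k) r = f := congrArg Subtype.val hr
  rw [← hr', ← map_pow, ← map_sub, ← map_add, map_eq_zero] at hf
  exact ratFunc_sq_sub_add_X_ne_zero r hf

end ValuedFieldExt

theorem mainTheorem4 (k : Type u) [Field k] :
    ValuedFieldExt.IsDefectless ((Polynomial.idealX k).valuation (RatFunc k)) ∧
      ¬ ValuedFieldExt.IsAlgebraicallyMaximal ((Polynomial.idealX k).valuation (RatFunc k)) :=
  ⟨ValuedFieldExt.isDefectless_idealX k, ValuedFieldExt.not_isAlgebraicallyMaximal_idealX k⟩
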